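/- Let $M$ be a closed (compact, without boundary) smooth manifold of dimension $n\ge 1$ with a Riemannian metric, and let $f\colon M\to M$ be of class $C^1$. For $x\in M$ put $$\|D_xf\|_{\mathrm{co}}=\min_{v\in T_xM,\ \|v\|=1}\|(D_xf)v\| ,$$ and call $x$ a critical point of $f$ if $D_xf$ is not surjective. Let $\Lambda\subseteq M$ be a set of periodic points of $f$ with $f(\Lambda)\subseteq\Lambda$ whose closure $\mathrm{Cl}(\Lambda)$ contains no critical point of $f$, and let $c>0$ be such that $$\limsup_{k\to+\infty}\frac1k\sum_{i=0}^{k-1}\log\|D_{f^i(x)}f\|_{\mathrm{co}}\ \ge\ c\qquad\text{for all }x\in\Lambda .$$ Then at least one of the following holds. 1. $f$ is uniformly expanding on $\mathrm{Cl}(\Lambda)$: there are $C>0$ and $\lambda>0$ such that $\|(D_xf^k)v\|\ge C\|v\|e^{k\lambda}$ for all $x\in\mathrm{Cl}(\Lambda)$, $v\in T_xM$ and $k\ge1$. 2. For every neighbourhood $V$ of $\mathrm{Cl}(\Lambda)$ in $M$ (equivalently, every $V$ that contains the $\eta$-neighbourhood of $\Lambda$ for some $\eta>0$), all real numbers $0<\gamma'<\gamma''<c$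 and every $T\in\mathbb N$ there is a periodic orbit $P\subseteq V$ of $f$, containing no critical point of $f$ and of minimal period $\tau\ge T$, and a point $p\in P$ such that $$\frac1\tau\sum_{i=0}^{\tau-1}\log\|D_{f^i(p)}f\|_{\mathrm{co}}<\gamma''$$ and $$\frac1k\sum_{i=1}^{k}\log\|D_{f^{\tau-i}(p)}f\|_{\mathrm{co}}>\gamma'\qquad\text{for all }k=1,\dots,\tau .$$ -/

import Mathlib

open Set Filter Topology Manifold Bundle
open scoped ContDiff

namespace C1Endo

/-- The co-norm (minimum norm) `min {‖T v‖ : ‖v‖ = 1}` of a linear map. -/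
noncomputable def conorm {E F : Type*} [NormedAddCommGroup E] [NormedSpace ℝ E]
    [NormedAddCommGroup F] [NormedSpace ℝ F] (T : E →L[ℝ] F) : ℝ :=
  sInf ((fun v : E => ‖T v‖) '' Metric.sphere (0 : E) 1)

/-- A critical point of a map of an `n`-manifold into itself: the derivative is not onto. -/
def IsCriticalPoint (n : ℕ) {M : Type*} [TopologicalSpace M]
    [ChartedSpace (EuclideanSpace ℝ (Fin n)) M] (f : M → M) (x : M) : Prop :=
  ¬ Function.Surjective (mfderiv (𝓡 n) (𝓡 n) f x)

/-- `log ‖D_x f‖_co`, for the norms on the tangent spaces given by a Riemannian metric;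
used only at noncritical points, where the co-norm is positive. -/
noncomputable def logConorm (n : ℕ) {M : Type*} [TopologicalSpace M]
    [ChartedSpace (EuclideanSpace ℝ (Fin n)) M] [IsManifold (𝓡 n) ∞ M]
    [RiemannianBundle (fun x : M => TangentSpace (𝓡 n) x)] (f : M → M) (x : M) : ℝ :=
  Real.log (conorm (mfderiv (𝓡 n) (𝓡 n) f x))

/-- `f` is uniformly expanding on `K`. -/
def UniformlyExpandingOn (n : ℕ) {M : Type*} [TopologicalSpace M]
    [ChartedSpace (EuclideanSpace ℝ (Fin n)) M] [IsManifold (𝓡 n) ∞ M]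
    [RiemannianBundle (fun x : M => TangentSpace (𝓡 n) x)] (f : M → M) (K : Set M) : Prop :=
  ∃ C > (0 : ℝ), ∃ lam > (0 : ℝ), ∀ x ∈ K, ∀ v : TangentSpace (𝓡 n) x, ∀ k : ℕ, 1 ≤ k →
    C * ‖v‖ * Real.exp (k * lam) ≤ ‖mfderiv (𝓡 n) (𝓡 n) (f^[k]) x v‖

end C1Endo

/-!
Put `φ = log ‖Df‖_co`; by the chain rule the Birkhoff sums `S_k φ` bound the expansion of `f^k` from
below. If every point of `Cl Λ` has some `S_k φ > k γ'/2`, compactness makes the Birkhoff sums grow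
linearly and uniformly, and `f` is uniformly expanding. Otherwise `Cl Λ` contains a slow point, with
`S_k φ ≤ k γ'/2` for all `k`.

Take a periodic point `q ∈ Λ`, of period `m`, that shadows the slow point for `N` steps, and
consider the drift `s_k = S_k φ(q) - k α` for a rate `α` between `γ'` and `γ''`; it is negative
during the first `N` steps but positive at time `m`. Orbit segments ending at a record time of `s`
are hyperbolic in the sense of Pliss, so they have contracting inverse branches on balls of a fixed
size. The segment from the last maximum of `s` on `[0, m]` to the next record is longer than `N` and
gains little drift. To close it up, cover `Cl Λ` by finitely many small balls and go on from record
to record, jumping between records in the same ball, until the orbit is back near its start. Once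
loops are erased, the number of jumps is bounded independently of `N`, and so is the drift gained.
The fixed point of the resulting contracting chain of inverse branches is periodic; its average is
below `γ''` when `N` is large, and since all its backward averages exceed `γ'`, the slow stretch of
`N` steps forces a large minimal period.
-/

namespace C1Endo

section Paths

open Relation

variable {β : Type*} {r : β → β → Prop}

theorem exists_nodup_isChain {a b : β} (h : ReflTransGen r a b) :
    ∃ l : List β, (a :: l).IsChain r ∧ (a :: l).getLast (List.cons_ne_nil a l) = b ∧
      (a :: l).Nodup := by
  induction h using ReflTransGen.head_induction_on with
  | refl => exact ⟨[], by simp⟩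
  | @head a c hac _ ih =>
    obtain ⟨l, hchain, hlast, hnodup⟩ := ih
    by_cases ha : a ∈ c :: l
    · obtain ⟨l₁, l₂, hl⟩ := List.append_of_mem ha
      have hsuffix : a :: l₂ <:+ c :: l := ⟨l₁, hl.symm⟩
      exact ⟨l₂, hchain.suffix hsuffix,
        (hsuffix.getLast (List.cons_ne_nil a l₂)).trans hlast, hnodup.sublist hsuffix.sublist⟩
    · exact ⟨c :: l, hchain.cons_cons hac, by simpa using hlast, hnodup.cons ha⟩

end Paths

section RecordTimes

open Relation

variable {s : ℕ → ℝ} {C : ℝ} {m n : ℕ}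

/-- A record time of the sequence `s`, ties being allowed. -/
def IsRecord (s : ℕ → ℝ) (n : ℕ) : Prop :=
  ∀ j ≤ n, s j ≤ s n

/-- The passage from a time to a later record time that exceeds it by at most `C`. -/
def RecordStep (s : ℕ → ℝ) (C : ℝ) (n n' : ℕ) : Prop :=
  n < n' ∧ IsRecord s n' ∧ s n' ≤ s n + C

theorem IsRecord.exists_recordStep (hstep : ∀ i, s (i + 1) ≤ s i + C) (hn : IsRecord s n)
    (hnm : n < m) (hs : s n ≤ s m) : ∃ n' ≤ m, RecordStep s C n n' := by
  classical
  have hex : ∃ k, n < k ∧ s n ≤ s k := ⟨m, hnm, hs⟩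
  have hbelow : ∀ j < Nat.find hex, s j ≤ s n := fun j hj => by
    rcases le_or_gt j n with hjn | hjn
    · exact hn j hjn
    · exact (not_le.1 fun h => Nat.find_min hex hj ⟨hjn, h⟩).le
  obtain ⟨hlt, hle⟩ := Nat.find_spec hex
  refine ⟨Nat.find hex, Nat.find_min' hex ⟨hnm, hs⟩, hlt, fun j hj => ?_, ?_⟩
  · rcases hj.lt_or_eq with hj | rfl
    · exact (hbelow j hj).trans hle
    · exact le_rfl
  · obtain ⟨k, hk⟩ := Nat.exists_eq_add_of_lt hlt
    rw [hk]
    exact (hstep _).trans (by linarith [hbelow (n + k) (by omega)])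

theorem IsRecord.reflTransGen_recordStep (hstep : ∀ i, s (i + 1) ≤ s i + C) (hn : IsRecord s n)
    (hm : IsRecord s m) (hnm : n ≤ m) : ReflTransGen (RecordStep s C) n m := by
  induction hd : m - n using Nat.strong_induction_on generalizing n with
  | _ d ih =>
    rcases hnm.eq_or_lt with rfl | hlt
    · exact .refl
    · obtain ⟨n', hn'm, hnn'⟩ := hn.exists_recordStep hstep hlt (hm n hnm)
      have := hnn'.1
      exact .head hnn' (ih (m - n') (by omega) hnn'.2.1 hn'm rfl)

theorem exists_last_max (s : ℕ → ℝ) (m : ℕ) :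
    ∃ n ≤ m, (∀ j ≤ m, s j ≤ s n) ∧ ∀ j ≤ m, n < j → s j < s n := by
  induction m with
  | zero => exact ⟨0, le_rfl, by simp, by omega⟩
  | succ m ih =>
    obtain ⟨n, hnm, hmax, hlast⟩ := ih
    rcases le_or_gt (s n) (s (m + 1)) with h | h
    · refine ⟨m + 1, le_rfl, fun j hj => ?_, by omega⟩
      rcases Nat.le_succ_iff.1 hj with hj | rfl
      exacts [(hmax j hj).trans h, le_rfl]
    · refine ⟨n, by omega, fun j hj => ?_, fun j hj hnj => ?_⟩
      · rcases Nat.le_succ_iff.1 hj with hj | rfl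
        exacts [hmax j hj, h.le]
      · rcases Nat.le_succ_iff.1 hj with hj | rfl
        exacts [hlast j hj hnj, h]

theorem isRecord_add_mul (hper : ∀ i, s (m + i) = s m + s i) (hm : 0 ≤ s m)
    (hmax : ∀ j ≤ m, s j ≤ s n) (hn : IsRecord s n) (j : ℕ) : IsRecord s (n + j * m) := by
  induction j with
  | zero => simpa using hn
  | succ j ih =>
    have hshift : s (n + (j + 1) * m) = s m + s (n + j * m) := by rw [← hper]; congr 1; ring
    intro i hi
    rw [hshift]
    rcases le_total i m with him | hmi
    · linarith [hmax i him, ih n (Nat.le_add_right _ _)]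
    · obtain ⟨i, rfl⟩ := Nat.exists_eq_add_of_le hmi
      rw [hper]
      linarith [ih i (by linarith)]

theorem exists_long_recordStep {N : ℕ} (hstep : ∀ i, s (i + 1) ≤ s i + C)
    (hper : ∀ i, s (m + i) = s m + s i) (hm : 0 < s m) (hslow : ∀ k, 1 ≤ k → k ≤ N → s k < 0) :
    ∃ n ≤ m, ∃ n' > m + N, RecordStep s C n n' ∧
      ∃ j, ReflTransGen (RecordStep s C) n' (n + j * m) := by
  obtain ⟨n, hnm, hmax, hlast⟩ := exists_last_max s m
  have hm0 : 0 < m := Nat.pos_of_ne_zero fun h => by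
    subst h
    linarith [hper 0]
  have hn : IsRecord s n := fun j hj => hmax j (hj.trans hnm)
  obtain ⟨n', -, hnn'⟩ := hn.exists_recordStep hstep (Nat.lt_add_of_pos_left hm0)
    (by linarith [hper n])
  have hlt : n < n' := hnn'.1
  have hn' : IsRecord s n' := hnn'.2.1
  refine ⟨n, hnm, n', ?_, hnn', n', hn'.reflTransGen_recordStep hstep
    (isRecord_add_mul hper hm.le hmax hn n') (by nlinarith)⟩
  by_contra! hle
  rcases le_or_gt n' m with hn'm | hmn'
  · exact (hlast n' hn'm hlt).not_ge (hn' n hlt.le)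
  · obtain ⟨k, rfl⟩ := Nat.exists_eq_add_of_le hmn'.le
    linarith [hper k, hslow k (by omega) (by omega), hmax m le_rfl, hn' n hlt.le]

end RecordTimes

section HyperbolicTimes

variable {X : Type*} {f : X → X} {φ ψ : X → ℝ} {l l' : ℕ} {x : X}

/-- A hyperbolic time, in the sense of Pliss, of the orbit of `x` for the potential `ψ`: all
final segments of `x, f x, …, f^[l - 1] x` have nonnegative Birkhoff sum. A rate `a` of
expansion is encoded by taking `ψ = φ - a`. -/
def IsHyperbolicTime (f : X → X) (ψ : X → ℝ) (l : ℕ) (x : X) : Prop :=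
  ∀ j k, j + k = l → 0 ≤ birkhoffSum f ψ k (f^[j] x)

theorem IsHyperbolicTime.birkhoffSum_nonneg (h : IsHyperbolicTime f ψ l x) :
    0 ≤ birkhoffSum f ψ l x :=
  h 0 l (zero_add l)

theorem IsHyperbolicTime.tail (h : IsHyperbolicTime f ψ (l + 1) x) :
    IsHyperbolicTime f ψ l (f x) := by
  intro j k hjk
  rw [← Function.iterate_succ_apply]
  exact h (j + 1) k (by omega)

theorem IsHyperbolicTime.append (h : IsHyperbolicTime f ψ l x)
    (h' : IsHyperbolicTime f ψ l' (f^[l] x)) : IsHyperbolicTime f ψ (l + l') x := by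
  intro j k hjk
  rcases le_total l j with hj | hj
  · obtain ⟨j, rfl⟩ := Nat.exists_eq_add_of_le' hj
    rw [Function.iterate_add_apply]
    exact h' j k (by omega)
  · obtain ⟨i, rfl⟩ := Nat.exists_eq_add_of_le' hj
    obtain rfl : k = i + l' := by omega
    rw [birkhoffSum_add, ← Function.iterate_add_apply, Nat.add_comm i j, Nat.add_comm j i]
    exact add_nonneg (h j i (Nat.add_comm j i)) h'.birkhoffSum_nonneg

theorem birkhoffSum_iterate_eq_sub (n k : ℕ) (x : X) :
    birkhoffSum f ψ k (f^[n] x) = birkhoffSum f ψ (n + k) x - birkhoffSum f ψ n x := by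
  rw [birkhoffSum_add, add_sub_cancel_left]

theorem isHyperbolicTime_of_isRecord {n : ℕ}
    (h : IsRecord (fun i => birkhoffSum f ψ i x) (n + l)) :
    IsHyperbolicTime f ψ l (f^[n] x) := by
  intro j k hjk
  rw [← Function.iterate_add_apply, Nat.add_comm j n, birkhoffSum_iterate_eq_sub, sub_nonneg,
    Nat.add_assoc, hjk]
  exact h (n + j) (by omega)

theorem birkhoffSum_add_const (a : ℝ) (k : ℕ) (x : X) :
    birkhoffSum f (φ · + a) k x = birkhoffSum f φ k x + k * a := by
  simp [birkhoffSum, Finset.sum_add_distrib]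

theorem birkhoffSum_sub_const (a : ℝ) (k : ℕ) (x : X) :
    birkhoffSum f (φ · - a) k x = birkhoffSum f φ k x - k * a := by
  simp [birkhoffSum, Finset.sum_sub_distrib]

theorem birkhoffSum_le_birkhoffSum {y : X} {k : ℕ} (h : ∀ i < k, φ (f^[i] x) ≤ ψ (f^[i] y)) :
    birkhoffSum f φ k x ≤ birkhoffSum f ψ k y :=
  Finset.sum_le_sum fun i hi => h i (Finset.mem_range.1 hi)

theorem birkhoffSum_mul_add {m : ℕ} (hx : Function.IsPeriodicPt f m x) (j i : ℕ) :
    birkhoffSum f φ (j * m + i) x = j * birkhoffSum f φ m x + birkhoffSum f φ i x := by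
  induction j with
  | zero => simp
  | succ j ih =>
    rw [show (j + 1) * m + i = m + (j * m + i) by ring, birkhoffSum_add, hx.eq, ih]
    push_cast
    ring

end HyperbolicTimes

section InverseBranches

variable {X : Type*} {f : X → X} {ψ : X → ℝ} {K V : Set X} {ρ : ENNReal} {l : ℕ} {x : X}

/-- Orbit segments of length `τ` that stay in `V`, are hyperbolic up to an error `ε`, and whose
Birkhoff sum exceeds `τ ε` by at most `E`. -/
def controlledSegments (f : X → X) (ψ : X → ℝ) (V : Set X) (ε E : ℝ) (τ : ℕ) : Set X :=
  {z | (∀ i < τ, f^[i] z ∈ V) ∧ IsHyperbolicTime f (ψ · + ε) τ z ∧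
    birkhoffSum f (ψ · - ε) τ z ≤ E}

theorem append_mem_controlledSegments {ε E E' : ℝ} {τ τ' : ℕ} {z : X}
    (h : z ∈ controlledSegments f ψ V ε E τ)
    (h' : f^[τ] z ∈ controlledSegments f ψ V ε E' τ') :
    z ∈ controlledSegments f ψ V ε (E + E') (τ + τ') := by
  refine ⟨fun i hi => ?_, h.2.1.append h'.2.1, ?_⟩
  · rcases lt_or_ge i τ with hiτ | hiτ
    · exact h.1 i hiτ
    · obtain ⟨j, rfl⟩ := Nat.exists_eq_add_of_le' hiτ
      rw [Function.iterate_add_apply]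
      exact h'.1 j (by omega)
  · rw [birkhoffSum_add]
    exact add_le_add h.2.2 h'.2.2

variable [EMetricSpace X]

/-- The closed Bowen (dynamical) ball: the points whose orbit stays `ρ`-close to that of `x` up
to time `l`, included. -/
def bowenBall (f : X → X) (l : ℕ) (x : X) (ρ : ENNReal) : Set X :=
  {z | ∀ i ≤ l, f^[i] z ∈ Metric.closedEBall (f^[i] x) ρ}

theorem bowenBall_subset_controlledSegments {ε E : ℝ}
    (hV : ∀ y ∈ K, Metric.closedEBall y ρ ⊆ V)
    (hosc : ∀ y ∈ K, ∀ z ∈ Metric.closedEBall y ρ, |ψ z - ψ y| ≤ ε) (hx : ∀ i, f^[i] x ∈ K)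
    (hhyp : IsHyperbolicTime f ψ l x) (hE : birkhoffSum f ψ l x ≤ E) :
    bowenBall f l x ρ ⊆ controlledSegments f ψ V ε E l := by
  intro z hz
  have hclose : ∀ i ≤ l, |ψ (f^[i] z) - ψ (f^[i] x)| ≤ ε := fun i hi =>
    hosc _ (hx i) _ (hz i hi)
  refine ⟨fun i hi => hV _ (hx i) (hz i hi.le), fun j k hjk => (hhyp j k hjk).trans ?_,
    le_trans ?_ hE⟩
  · refine birkhoffSum_le_birkhoffSum fun i hi => ?_
    simp only [← Function.iterate_add_apply]
    linarith [(abs_le.1 (hclose (i + j) (by omega))).1]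
  · exact birkhoffSum_le_birkhoffSum fun i hi => by linarith [(abs_le.1 (hclose i hi.le)).2]

/-- Every point `f x` with `x ∈ K` has a local inverse of `f` on its `ρ`-ball that sends it to `x`
and contracts by the factor `exp (-ψ x)`. -/
def HasInverseBranches (f : X → X) (ψ : X → ℝ) (K : Set X) (ρ : ENNReal) : Prop :=
  ∀ x ∈ K, ∃ g : X → X, g (f x) = x ∧
    LipschitzOnWith (Real.toNNReal (Real.exp (-ψ x))) g (Metric.closedEBall (f x) ρ) ∧
    RightInvOn g f (Metric.closedEBall (f x) ρ)

theorem HasInverseBranches.mono {K' : Set X} {ρ' : ENNReal} (h : HasInverseBranches f ψ K ρ)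
    (hK : K' ⊆ K) (hρ : ρ' ≤ ρ) : HasInverseBranches f ψ K' ρ' := fun x hx => by
  obtain ⟨g, hgx, hgL, hg⟩ := h x (hK hx)
  have hball := Metric.closedEBall_subset_closedEBall (x := f x) hρ
  exact ⟨g, hgx, hgL.mono hball, hg.mono hball⟩

theorem HasInverseBranches.union {K' : Set X} (h : HasInverseBranches f ψ K ρ)
    (h' : HasInverseBranches f ψ K' ρ) : HasInverseBranches f ψ (K ∪ K') ρ :=
  fun x hx => hx.elim (h x) (h' x)

theorem HasInverseBranches.iterate (hbr : HasInverseBranches f ψ K ρ)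
    (hx : ∀ i, f^[i] x ∈ K) (hhyp : IsHyperbolicTime f ψ l x) : ∃ G : X → X, G (f^[l] x) = x ∧
      LipschitzOnWith (Real.toNNReal (Real.exp (-birkhoffSum f ψ l x))) G
        (Metric.closedEBall (f^[l] x) ρ) ∧
      ∀ w ∈ Metric.closedEBall (f^[l] x) ρ, f^[l] (G w) = w ∧ G w ∈ bowenBall f l x ρ := by
  induction l generalizing x with
  | zero =>
    refine ⟨id, rfl, by simpa using LipschitzWith.id.lipschitzOnWith, fun w hw => ⟨rfl, ?_⟩⟩
    intro i hi
    obtain rfl := Nat.le_zero.1 hi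
    exact hw
  | succ l ih =>
    obtain ⟨G, hGx, hGL, hG⟩ := ih (x := f x) (fun i => hx (i + 1)) hhyp.tail
    obtain ⟨g, hgx, hgL, hg⟩ := hbr x (hx 0)
    have hmaps : MapsTo G (Metric.closedEBall (f^[l] (f x)) ρ) (Metric.closedEBall (f x) ρ) :=
      fun w hw => (hG w hw).2 0 (Nat.zero_le l)
    have hL : LipschitzOnWith (Real.toNNReal (Real.exp (-birkhoffSum f ψ (l + 1) x))) (g ∘ G)
        (Metric.closedEBall (f^[l] (f x)) ρ) := by
      convert hgL.comp hGL hmaps using 1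
      rw [← Real.toNNReal_mul (Real.exp_pos _).le, ← Real.exp_add, birkhoffSum_succ', neg_add]
    have hfix : (g ∘ G) (f^[l] (f x)) = x := by rw [Function.comp_apply, hGx, hgx]
    refine ⟨g ∘ G, hfix, hL, fun w hw => ?_⟩
    have hfG : f ((g ∘ G) w) = G w := hg (hmaps hw)
    refine ⟨by rw [Function.iterate_succ_apply, hfG, (hG w hw).1], fun i hi => ?_⟩
    cases i with
    | zero =>
      -- hyperbolicity makes the composite nonexpanding, so it returns into the `ρ`-ball at `x`
      have hnonexp : Real.toNNReal (Real.exp (-birkhoffSum f ψ (l + 1) x)) ≤ 1 := by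
        rw [Real.toNNReal_le_one, Real.exp_le_one_iff, neg_nonpos]
        exact hhyp.birkhoffSum_nonneg
      have hdist := hL.weaken hnonexp hw (Metric.mem_closedEBall_self (x := f^[l] (f x)))
      rw [hfix, ENNReal.coe_one, one_mul] at hdist
      exact hdist.trans hw
    | succ i =>
      rw [Function.iterate_succ_apply, Function.iterate_succ_apply, hfG]
      exact (hG w hw).2 i (by omega)

end InverseBranches

section Branches

variable {X : Type*} [EMetricSpace X] {f : X → X} {ψ : X → ℝ} {K V S S' : Set X} {κ : NNReal}
  {ρ : ENNReal} {τ τ' : ℕ} {a b a' b' x : X}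

/-- A branch of the inverse of `f^[τ]` that maps the closed `ρ`-ball at `b` into the closed
`κ ρ`-ball at `a`, is `κ`-Lipschitz, and takes its values in `S`. -/
def IsBranch (f : X → X) (κ : NNReal) (ρ : ENNReal) (τ : ℕ) (S : Set X) (a b : X) : Prop :=
  ∃ G : X → X, LipschitzOnWith κ G (Metric.closedEBall b ρ) ∧
    ∀ w ∈ Metric.closedEBall b ρ,
      G w ∈ Metric.closedEBall a (κ * ρ) ∧ f^[τ] (G w) = w ∧ G w ∈ S

theorem IsBranch.mono (h : IsBranch f κ ρ τ S a b) (hS : S ⊆ S') : IsBranch f κ ρ τ S' a b := by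
  obtain ⟨G, hGL, hG⟩ := h
  exact ⟨G, hGL, fun w hw => ⟨(hG w hw).1, (hG w hw).2.1, hS (hG w hw).2.2⟩⟩

theorem closedEBall_subset_closedEBall_of_edist_add_le {r : ENNReal} (h : edist a b + r ≤ ρ) :
    Metric.closedEBall a r ⊆ Metric.closedEBall b ρ := fun w hw =>
  calc edist w b ≤ edist w a + edist a b := edist_triangle _ _ _
    _ ≤ r + edist a b := add_le_add_left hw _
    _ ≤ ρ := by rwa [add_comm]

theorem IsBranch.comp (hκ : κ ≤ 1) (h : IsBranch f κ ρ τ S a b)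
    (h' : IsBranch f κ ρ τ' S' a' b') (hab : edist a' b + κ * ρ ≤ ρ) :
    IsBranch f κ ρ (τ + τ') (S ∩ f^[τ] ⁻¹' S') a b' := by
  obtain ⟨G, hGL, hG⟩ := h
  obtain ⟨G', hGL', hG'⟩ := h'
  have hmaps : MapsTo G' (Metric.closedEBall b' ρ) (Metric.closedEBall b ρ) := fun w hw =>
    closedEBall_subset_closedEBall_of_edist_add_le hab (hG' w hw).1
  refine ⟨G ∘ G', (hGL.comp hGL' hmaps).weaken (mul_le_of_le_one_right' hκ), fun w hw => ?_⟩
  obtain ⟨hball, hinv, hS⟩ := hG _ (hmaps hw)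
  obtain ⟨-, hinv', hS'⟩ := hG' w hw
  refine ⟨hball, ?_, hS, ?_⟩
  · rw [Nat.add_comm, Function.iterate_add_apply, Function.comp_apply, hinv, hinv']
  · rwa [mem_preimage, Function.comp_apply, hinv]

theorem IsBranch.exists_isPeriodicPt (hb : IsComplete (Metric.closedEBall b ρ)) (hκ : κ < 1)
    (hρ : ρ ≠ ⊤) (h : IsBranch f κ ρ τ S a b) (hab : edist a b + κ * ρ ≤ ρ) :
    ∃ p ∈ S, Function.IsPeriodicPt f τ p := by
  obtain ⟨G, hGL, hG⟩ := h
  have hmaps : MapsTo G (Metric.closedEBall b ρ) (Metric.closedEBall b ρ) := fun w hw =>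
    closedEBall_subset_closedEBall_of_edist_add_le hab (hG w hw).1
  have hself : b ∈ Metric.closedEBall b ρ := Metric.mem_closedEBall_self
  obtain ⟨p, hp, hfix, -⟩ := ContractingWith.exists_fixedPoint' hb hmaps
    ⟨hκ, hGL.mapsToRestrict hmaps⟩ hself
    (ne_top_of_le_ne_top hρ (by rw [edist_comm]; exact hmaps hself))
  obtain ⟨-, hper, hpS⟩ := hG p hp
  rw [hfix.eq] at hper hpS
  exact ⟨p, hpS, hper⟩

theorem HasInverseBranches.isBranch {β : ℝ} (hβ : 0 ≤ β)
    (hbr : HasInverseBranches f (ψ · + β) K ρ) (hx : ∀ i, f^[i] x ∈ K) (hτ : 1 ≤ τ)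
    (hhyp : IsHyperbolicTime f ψ τ x) :
    IsBranch f (Real.toNNReal (Real.exp (-β))) ρ τ (bowenBall f τ x ρ) x (f^[τ] x) := by
  have hhyp' : IsHyperbolicTime f (ψ · + β) τ x := fun j k hjk => by
    rw [birkhoffSum_add_const]
    have := hhyp j k hjk
    positivity
  obtain ⟨G, hGx, hGL, hG⟩ := hbr.iterate hx hhyp'
  have hexp : Real.exp (-birkhoffSum f (ψ · + β) τ x) ≤ Real.exp (-β) := by
    rw [Real.exp_le_exp, neg_le_neg_iff, birkhoffSum_add_const]
    have : β ≤ τ * β := le_mul_of_one_le_left hβ (by exact_mod_cast hτ)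
    linarith [hhyp.birkhoffSum_nonneg]
  have hGL' := hGL.weaken (Real.toNNReal_le_toNNReal hexp)
  refine ⟨G, hGL', fun w hw => ⟨?_, hG w hw⟩⟩
  have hdist := hGL' hw (Metric.mem_closedEBall_self (x := f^[τ] x))
  rw [hGx] at hdist
  exact hdist.trans (mul_le_mul_right hw _)

theorem IsBranch.exists_of_isChain {β : Type*} {lab : K → β} {r : β → β → Prop} {Q : Set X}
    {ε E C : ℝ} (hκ : κ ≤ 1) (hlab : ∀ x y : K, lab x = lab y → edist (x : X) y + κ * ρ ≤ ρ)
    (hr : ∀ u v, r u v → ∃ a b : K, lab a = u ∧ lab b = v ∧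
      ∃ τ, IsBranch f κ ρ τ (controlledSegments f ψ V ε C τ) a b)
    {b : K} (h : IsBranch f κ ρ τ (Q ∩ controlledSegments f ψ V ε E τ) a b)
    (l : List β) (hl : (lab b :: l).IsChain r) :
    ∃ b' : K, lab b' = (lab b :: l).getLast (List.cons_ne_nil _ _) ∧ ∃ τ' ≥ τ,
      IsBranch f κ ρ τ' (Q ∩ controlledSegments f ψ V ε (E + l.length * C) τ') a b' := by
  induction l generalizing b τ E with
  | nil => exact ⟨b, rfl, τ, le_rfl, by simpa using h⟩
  | cons v l ih =>
    rw [List.isChain_cons_cons] at hl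
    obtain ⟨c, d, hc, rfl, σ, hcd⟩ := hr _ _ hl.1
    have hcomp := (h.comp hκ hcd (hlab c b hc)).mono
      (S' := Q ∩ controlledSegments f ψ V ε (E + C) (τ + σ))
      fun z hz => ⟨hz.1.1, append_mem_controlledSegments hz.1.2 hz.2⟩
    obtain ⟨b', hb', τ', hτ', h'⟩ := ih hcomp hl.2
    refine ⟨b', by simpa using hb', τ', by omega, ?_⟩
    convert h' using 3
    push_cast [List.length_cons]
    ring

end Branches

section Scale

open Relation

variable {X : Type*} [EMetricSpace X] {f : X → X} {φ ψ : X → ℝ} {K V : Set X}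

theorem exists_closedEBall_subset (hK : IsCompact K) (hV : V ∈ 𝓝ˢ K) :
    ∃ ρ : ENNReal, 0 < ρ ∧ ∀ x ∈ K, Metric.closedEBall x ρ ⊆ V := by
  obtain ⟨ρ, hρ, hsub⟩ := (hK.nhdsSet_basis_uniformity uniformity_basis_edist_le).mem_iff.1 hV
  refine ⟨ρ, hρ, fun x hx y hy => hsub (mem_biUnion hx ?_)⟩
  rwa [Metric.mem_closedEBall, edist_comm] at hy

theorem exists_oscillation_le (hK : IsCompact K) (hφ : ∀ x ∈ K, ContinuousAt φ x) {ε : ℝ}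
    (hε : 0 < ε) :
    ∃ ρ : ENNReal, 0 < ρ ∧ ∀ x ∈ K, ∀ y ∈ Metric.closedEBall x ρ, |φ y - φ x| ≤ ε := by
  obtain ⟨ρ, hρ, hsub⟩ := uniformity_basis_edist_le.mem_iff.1
    (hK.uniformContinuousAt_of_continuousAt φ hφ (Metric.dist_mem_uniformity hε))
  refine ⟨ρ, hρ, fun x hx y hy => ?_⟩
  rw [Metric.mem_closedEBall, edist_comm] at hy
  have hdist : dist (φ x) (φ y) < ε := hsub (show (x, y) ∈ _ from hy) hx
  rw [abs_sub_comm]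
  exact hdist.le

theorem exists_isCompact_closedEBall [WeaklyLocallyCompactSpace X] (hK : IsCompact K) :
    ∃ ρ : ENNReal, 0 < ρ ∧ ∀ x ∈ K, IsCompact (Metric.closedEBall x ρ) := by
  obtain ⟨L, hL, hKL⟩ := exists_compact_superset hK
  obtain ⟨ρ, hρ, hsub⟩ := exists_closedEBall_subset hK (subset_interior_iff_mem_nhdsSet.1 hKL)
  exact ⟨ρ, hρ, fun x hx => hL.of_isClosed_subset Metric.isClosed_closedEBall (hsub x hx)⟩

theorem exists_finite_labels (hK : TotallyBounded K) {η : ENNReal} (hη : 0 < η) :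
    ∃ (t : Finset X) (lab : K → t), ∀ x y : K, lab x = lab y → edist (x : X) y ≤ η := by
  obtain ⟨t, ht, hcover⟩ := EMetric.totallyBounded_iff.1 hK (η / 2) (ENNReal.half_pos hη.ne')
  have hnear : ∀ x : K, ∃ z : ht.toFinset, edist (x : X) z < η / 2 := fun x => by
    obtain ⟨z, hz, hxz⟩ := mem_iUnion₂.1 (hcover x.2)
    exact ⟨⟨z, ht.mem_toFinset.2 hz⟩, hxz⟩
  choose lab hlab using hnear
  refine ⟨ht.toFinset, lab, fun x y hxy => ?_⟩
  calc edist (x : X) y ≤ edist (x : X) (lab x) + edist (y : X) (lab x) :=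
        edist_triangle_right _ _ _
    _ ≤ η / 2 + η / 2 := add_le_add (hlab x).le (by rw [hxy]; exact (hlab y).le)
    _ = η := ENNReal.add_halves η

/-- A radius `ρ` adapted to `K`: the closed `ρ`-balls centred in `K` are compact and contained in
`V`, `ψ` oscillates by at most `ε` on them, and the inverse branches of `f` along `K` contract by
`exp (-(ψ + β))`. -/
structure IsAdaptedScale (f : X → X) (ψ : X → ℝ) (K V : Set X) (β ε : ℝ) (ρ : ENNReal) :
    Prop where
  pos : 0 < ρ
  ne_top : ρ ≠ ⊤
  isCompact : ∀ x ∈ K, IsCompact (Metric.closedEBall x ρ)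
  subset : ∀ x ∈ K, Metric.closedEBall x ρ ⊆ V
  oscillation : ∀ x ∈ K, ∀ y ∈ Metric.closedEBall x ρ, |ψ y - ψ x| ≤ ε
  hasInverseBranches : HasInverseBranches f (ψ · + β) K ρ

theorem exists_isAdaptedScale [WeaklyLocallyCompactSpace X] (hK : IsCompact K)
    (hψ : ∀ x ∈ K, ContinuousAt ψ x) (hV : V ∈ 𝓝ˢ K) {β ε : ℝ} (hε : 0 < ε)
    (hbr : ∃ ρ : ENNReal, 0 < ρ ∧ HasInverseBranches f (ψ · + β) K ρ) :
    ∃ ρ, IsAdaptedScale f ψ K V β ε ρ := by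
  obtain ⟨ρ₁, hρ₁, hbr⟩ := hbr
  obtain ⟨ρ₂, hρ₂, hcompact⟩ := exists_isCompact_closedEBall hK
  obtain ⟨ρ₃, hρ₃, hsub⟩ := exists_closedEBall_subset hK hV
  obtain ⟨ρ₄, hρ₄, hosc⟩ := exists_oscillation_le hK hψ hε
  obtain ⟨ρ, hρ, hlt⟩ := exists_between
    (lt_min one_pos (lt_min (lt_min hρ₁ hρ₂) (lt_min hρ₃ hρ₄)))
  simp only [lt_min_iff] at hlt
  obtain ⟨h1, ⟨hlt₁, hlt₂⟩, hlt₃, hlt₄⟩ := hlt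
  have hball : ∀ (x : X) {r}, ρ < r → Metric.closedEBall x ρ ⊆ Metric.closedEBall x r :=
    fun x r hr => Metric.closedEBall_subset_closedEBall hr.le
  exact ⟨ρ, hρ, h1.ne_top,
    fun x hx => (hcompact x hx).of_isClosed_subset Metric.isClosed_closedEBall (hball x hlt₂),
    fun x hx => (hball x hlt₃).trans (hsub x hx), fun x hx y hy => hosc x hx y (hball x hlt₄ hy),
    hbr.mono Subset.rfl hlt₁.le⟩

variable {β ε C : ℝ} {ρ : ENNReal} {q : X} {n n' : ℕ}

theorem IsAdaptedScale.isBranch (h : IsAdaptedScale f ψ K V β ε ρ) (hβ : 0 ≤ β)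
    (hq : ∀ i, f^[i] q ∈ K) (hnn' : RecordStep (birkhoffSum f ψ · q) C n n') :
    IsBranch f (Real.toNNReal (Real.exp (-β))) ρ (n' - n)
      (bowenBall f (n' - n) (f^[n] q) ρ ∩ controlledSegments f ψ V ε C (n' - n))
      (f^[n] q) (f^[n'] q) := by
  obtain ⟨hlt, hrec, hC⟩ := hnn'
  obtain ⟨l, rfl⟩ := Nat.exists_eq_add_of_lt hlt
  have horb : ∀ i, f^[i] (f^[n] q) ∈ K := fun i => by
    rw [← Function.iterate_add_apply]
    exact hq _
  have hhyp : IsHyperbolicTime f ψ (l + 1) (f^[n] q) := isHyperbolicTime_of_isRecord hrec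
  have hsum : birkhoffSum f ψ (l + 1) (f^[n] q) ≤ C := by
    rw [birkhoffSum_iterate_eq_sub]
    exact sub_le_iff_le_add'.2 hC
  rw [show n + l + 1 - n = l + 1 by omega, show n + l + 1 = l + 1 + n by omega,
    Function.iterate_add_apply]
  exact (h.hasInverseBranches.isBranch hβ horb (Nat.le_add_left 1 l) hhyp).mono
    (subset_inter Subset.rfl
      (bowenBall_subset_controlledSegments h.subset h.oscillation horb hhyp hsum))

theorem IsAdaptedScale.exists_finite_labels (h : IsAdaptedScale f ψ K V β ε ρ) (hβ : 0 < β)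
    (hK : TotallyBounded K) : ∃ (t : Finset X) (lab : K → t), ∀ x y : K, lab x = lab y →
      edist (x : X) y + Real.toNNReal (Real.exp (-β)) * ρ ≤ ρ := by
  have hκ : Real.toNNReal (Real.exp (-β)) < 1 := by
    rwa [Real.toNNReal_lt_one, Real.exp_lt_one_iff, neg_lt_zero]
  have hκρ : Real.toNNReal (Real.exp (-β)) * ρ < ρ := by
    simpa using ENNReal.mul_lt_mul_left h.pos.ne' h.ne_top (ENNReal.coe_lt_coe.2 hκ)
  obtain ⟨t, lab, hlab⟩ := C1Endo.exists_finite_labels hK (tsub_pos_of_lt hκρ)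
  exact ⟨t, lab, fun x y hxy =>
    (add_le_add_left (hlab x y hxy) _).trans_eq (tsub_add_cancel_of_le hκρ.le)⟩

/-- The return from `f^[n'] q` to `f^[n] q` may take arbitrarily many record steps, but after
loop-erasing its itinerary among the labels it costs at most one excess `C` per label. -/
theorem IsAdaptedScale.exists_isPeriodicPt (h : IsAdaptedScale f ψ K V β ε ρ) (hβ : 0 < β)
    {α : Type*} [Fintype α] {lab : K → α}
    (hlab : ∀ x y : K, lab x = lab y →
      edist (x : X) y + Real.toNNReal (Real.exp (-β)) * ρ ≤ ρ)
    (hC : 0 ≤ C) (hq : ∀ i, f^[i] q ∈ K) (hnn' : RecordStep (birkhoffSum f ψ · q) C n n')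
    {n'' : ℕ} (hreturn : ReflTransGen (RecordStep (birkhoffSum f ψ · q) C) n' n'')
    (hper : f^[n''] q = f^[n] q) :
    ∃ p, ∃ τ ≥ n' - n, Function.IsPeriodicPt f τ p ∧ p ∈ bowenBall f (n' - n) (f^[n] q) ρ ∧
      p ∈ controlledSegments f ψ V ε (Fintype.card α * C) τ := by
  set κ := Real.toNNReal (Real.exp (-β))
  have hκ : κ < 1 := by rwa [Real.toNNReal_lt_one, Real.exp_lt_one_iff, neg_lt_zero]
  let orbit : ℕ → K := fun i => ⟨f^[i] q, hq i⟩
  let r : α → α → Prop := fun u v => ∃ a b : K, lab a = u ∧ lab b = v ∧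
    ∃ τ, IsBranch f κ ρ τ (controlledSegments f ψ V ε C τ) a b
  have hpath : ReflTransGen r (lab (orbit n')) (lab (orbit n'')) :=
    hreturn.lift (fun i => lab (orbit i)) fun i j hij =>
      ⟨orbit i, orbit j, rfl, rfl, j - i, (h.isBranch hβ.le hq hij).mono inter_subset_right⟩
  obtain ⟨l, hchain, hlast, hnodup⟩ := exists_nodup_isChain hpath
  obtain ⟨b, hb, τ, hτ, hbranch⟩ := IsBranch.exists_of_isChain hκ.le hlab (fun _ _ huv => huv)
    (b := orbit n') (h.isBranch hβ.le hq hnn') l hchain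
  have hclose : lab (orbit n) = lab b := by
    rw [hb, hlast]
    exact congrArg lab (Subtype.ext hper.symm)
  obtain ⟨p, ⟨hbowen, hV, hhyp, hsum⟩, hp⟩ := hbranch.exists_isPeriodicPt
    (h.isCompact b b.2).isComplete hκ h.ne_top (hlab _ _ hclose)
  refine ⟨p, τ, hτ, hp, hbowen, hV, hhyp, hsum.trans ?_⟩
  have hcard : ((l.length : ℝ) + 1) ≤ Fintype.card α := by exact_mod_cast hnodup.length_le_card
  linarith [mul_le_mul_of_nonneg_right hcard hC]

theorem iterate_mem_bowenBall {l j k : ℕ} {x z : X} (hz : z ∈ bowenBall f l x ρ)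
    (hjk : j + k ≤ l) : f^[j] z ∈ bowenBall f k (f^[j] x) ρ := fun i hi => by
  simp only [← Function.iterate_add_apply]
  exact hz (i + j) (by omega)

theorem IsAdaptedScale.exists_isPeriodicPt_of_slow (h : IsAdaptedScale f ψ K V β ε ρ)
    (hβ : 0 < β) {α : Type*} [Fintype α] {lab : K → α}
    (hlab : ∀ x y : K, lab x = lab y →
      edist (x : X) y + Real.toNNReal (Real.exp (-β)) * ρ ≤ ρ)
    (hC : ∀ x ∈ K, |ψ x| ≤ C) (hq : ∀ i, f^[i] q ∈ K) {m N : ℕ}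
    (hm : Function.IsPeriodicPt f m q) (hpos : 0 < birkhoffSum f ψ m q)
    (hslow : ∀ k, 1 ≤ k → k ≤ N → birkhoffSum f ψ k q < 0) :
    ∃ p, ∃ τ > N, Function.IsPeriodicPt f τ p ∧
      p ∈ controlledSegments f ψ V ε (Fintype.card α * C) τ ∧ ∃ j, f^[j] p ∈ bowenBall f N q ρ := by
  have hstep : ∀ i, birkhoffSum f ψ (i + 1) q ≤ birkhoffSum f ψ i q + C := fun i => by
    rw [birkhoffSum_succ]
    linarith [(abs_le.1 (hC _ (hq i))).2]
  obtain ⟨n, hnm, n', hn', hnn', j, hreturn⟩ := exists_long_recordStep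
    (s := (birkhoffSum f ψ · q)) hstep (fun i => by rw [birkhoffSum_add, hm.eq]) hpos hslow
  have hper : f^[n + j * m] q = f^[n] q := by
    rw [Function.iterate_add_apply, (hm.const_mul j).eq]
  obtain ⟨p, τ, hτ, hp, hbowen, hctrl⟩ := h.exists_isPeriodicPt hβ hlab
    ((abs_nonneg _).trans (hC _ (hq 0))) hq hnn' hreturn hper
  refine ⟨p, τ, by omega, hp, hctrl, m - n, ?_⟩
  have := iterate_mem_bowenBall (j := m - n) (k := N) hbowen (by omega)
  rwa [← Function.iterate_add_apply, Nat.sub_add_cancel hnm, hm.eq] at this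

end Scale

section SlowPoints

variable {X : Type*} {f : X → X} {φ : X → ℝ}

theorem continuousAt_birkhoffSum [TopologicalSpace X] (hf : Continuous f) {x : X}
    (hφ : ∀ i, ContinuousAt φ (f^[i] x)) (k : ℕ) : ContinuousAt (birkhoffSum f φ k) x :=
  tendsto_finsetSum _ fun i _ =>
    ContinuousAt.comp (g := φ) (f := f^[i]) (hφ i) (hf.iterate i).continuousAt

theorem exists_mem_birkhoffSum_lt [TopologicalSpace X] (hf : Continuous f) {S : Set X} {x : X}
    (hx : x ∈ closure S) (hφ : ∀ i, ContinuousAt φ (f^[i] x)) {a₀ a : ℝ} (ha : a₀ < a)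
    (hslow : ∀ k : ℕ, 1 ≤ k → birkhoffSum f φ k x ≤ k * a₀) (N : ℕ) :
    ∃ q ∈ S, ∀ k : ℕ, 1 ≤ k → k ≤ N → birkhoffSum f φ k q < k * a := by
  have hnear : ∀ᶠ y in 𝓝 x, ∀ k ∈ Finset.Icc 1 N, birkhoffSum f φ k y < k * a := by
    rw [Filter.eventually_all_finset]
    intro k hk
    have hk1 : 1 ≤ k := (Finset.mem_Icc.1 hk).1
    have hk0 : (0 : ℝ) < k := by exact_mod_cast hk1
    exact (continuousAt_birkhoffSum hf hφ k).eventually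
      (Iio_mem_nhds ((hslow k hk1).trans_lt (mul_lt_mul_of_pos_left ha hk0)))
  obtain ⟨q, hq, hqS⟩ := mem_closure_iff_nhds.1 hx _ hnear
  exact ⟨q, hqS, fun k hk1 hkN => hq k (Finset.mem_Icc.2 ⟨hk1, hkN⟩)⟩

theorem exists_le_natCast_mul_gt (T : ℕ) (B : ℝ) {a : ℝ} (ha : 0 < a) :
    ∃ N : ℕ, T ≤ N ∧ B < N * a := by
  obtain ⟨N, hN⟩ := exists_nat_gt (B / a)
  refine ⟨max T N, le_max_left T N, ((div_lt_iff₀ ha).1 hN).trans_le ?_⟩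
  gcongr
  exact le_max_right T N

/-- A periodic point of `Λ` near the slow point `x` is closed up along the record times of its
drift at an intermediate rate `α`; the slow initial stretch survives and bounds the period. -/
theorem exists_isPeriodicPt_of_slow_point [EMetricSpace X] [WeaklyLocallyCompactSpace X]
    (hf : Continuous f) {Λ V : Set X} (hK : IsCompact (closure Λ)) (hΛ : MapsTo f Λ Λ)
    (hφ : ∀ x ∈ closure Λ, ContinuousAt φ x) (hV : V ∈ 𝓝ˢ (closure Λ))
    (hbr : ∀ ε : ℝ, 0 < ε → ∃ ρ : ENNReal, 0 < ρ ∧ HasInverseBranches f (φ · - ε) (closure Λ) ρ)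
    {a₀ a₁ a₂ c : ℝ} (ha₁ : 0 < a₁) (ha₀₁ : a₀ < a₁) (ha₁₂ : a₁ < a₂) (ha₂ : a₂ < c)
    (havg : ∀ x ∈ Λ, ∃ m, 0 < m ∧ Function.IsPeriodicPt f m x ∧ m * c ≤ birkhoffSum f φ m x)
    {x : X} (hx : x ∈ closure Λ) (hslow : ∀ k : ℕ, 1 ≤ k → birkhoffSum f φ k x ≤ k * a₀)
    (T : ℕ) :
    ∃ p, ∃ τ > 0, Function.IsPeriodicPt f τ p ∧ (∀ i < τ, f^[i] p ∈ V) ∧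
      (∃ a > a₁, IsHyperbolicTime f (φ · - a) τ p) ∧ birkhoffSum f φ τ p < τ * a₂ ∧
      ∃ j, ∀ k : ℕ, 1 ≤ k → k ≤ T → birkhoffSum f φ k (f^[j] p) < k * a₁ := by
  obtain ⟨α, hα₁, hα₂⟩ := exists_between ha₁₂
  obtain ⟨ε, hε, hεlt⟩ := exists_between
    (lt_min (sub_pos.2 hα₁) (lt_min (sub_pos.2 hα₂) (half_pos (sub_pos.2 ha₀₁))))
  simp only [lt_min_iff] at hεlt
  obtain ⟨hεα₁, hεα₂, hεa₀⟩ := hεlt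
  have hβ : 0 < α - ε := by linarith
  have hψ : ∀ x ∈ closure Λ, ContinuousAt (φ · - α) x := fun x hx => (hφ x hx).sub_const α
  have hfK : MapsTo f (closure Λ) (closure Λ) := hΛ.closure hf
  obtain ⟨ρ, hscale⟩ := exists_isAdaptedScale (β := α - ε) hK hψ hV hε (by simpa using hbr ε hε)
  obtain ⟨t, lab, hlab⟩ := hscale.exists_finite_labels hβ hK.totallyBounded
  obtain ⟨C, hC⟩ := hK.exists_bound_of_continuousOn fun x hx => (hψ x hx).continuousWithinAt
  obtain ⟨N, hTN, hN⟩ := exists_le_natCast_mul_gt T (Fintype.card t * C)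
    (show 0 < a₂ - (α + ε) by linarith)
  obtain ⟨q, hqΛ, hqslow⟩ := exists_mem_birkhoffSum_lt hf hx
    (fun i => hφ _ (hfK.iterate i hx)) (show a₀ < a₁ - ε by linarith) hslow N
  have hq : ∀ i, f^[i] q ∈ closure Λ := fun i => subset_closure (hΛ.iterate i hqΛ)
  obtain ⟨m, hm, hqm, hqavg⟩ := havg q hqΛ
  have hpos : 0 < birkhoffSum f (φ · - α) m q := by
    rw [birkhoffSum_sub_const, sub_pos]
    exact lt_of_lt_of_le (by gcongr; linarith) hqavg
  have hneg : ∀ k, 1 ≤ k → k ≤ N → birkhoffSum f (φ · - α) k q < 0 := fun k hk hkN => by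
    rw [birkhoffSum_sub_const, sub_neg]
    exact (hqslow k hk hkN).trans_le (by gcongr; linarith)
  obtain ⟨p, τ, hτ, hp, ⟨hpV, hhyp, hsum⟩, j, hj⟩ :=
    hscale.exists_isPeriodicPt_of_slow hβ hlab hC hq hqm hpos hneg
  refine ⟨p, τ, by omega, hp, hpV, ⟨α - ε, by linarith, by simpa only [sub_add] using hhyp⟩, ?_,
    j, fun k hk hkT => ?_⟩
  · rw [birkhoffSum_sub_const, birkhoffSum_sub_const] at hsum
    have : (N : ℝ) * (a₂ - (α + ε)) ≤ τ * (a₂ - (α + ε)) := by gcongr; linarith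
    linarith
  · have hshadow : birkhoffSum f φ k (f^[j] p) ≤ birkhoffSum f (φ · + ε) k q :=
      birkhoffSum_le_birkhoffSum fun i hi => by
        linarith [(abs_le.1 (hscale.oscillation _ (hq i) _ (hj i (by omega)))).2]
    rw [birkhoffSum_add_const] at hshadow
    linarith [hqslow k hk (hkT.trans hTN)]

end SlowPoints

section PeriodicOrbits

variable {X : Type*} {f : X → X} {φ ψ : X → ℝ} {x : X} {m τ : ℕ}

theorem IsHyperbolicTime.of_dvd (h : IsHyperbolicTime f ψ τ x) (hx : Function.IsPeriodicPt f m x)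
    (hτ : 0 < τ) (hdvd : m ∣ τ) : IsHyperbolicTime f ψ m x := by
  intro j k hjk
  obtain ⟨d, rfl⟩ := hdvd
  obtain ⟨d, rfl⟩ := Nat.exists_eq_add_of_le' (Nat.pos_of_mul_pos_left hτ)
  have hk := h (j + d * m) k (by rw [← hjk]; ring)
  rwa [Function.iterate_add_apply, (hx.const_mul d).eq] at hk

theorem IsHyperbolicTime.mul_le_birkhoffSum {a : ℝ} (h : IsHyperbolicTime f (φ · - a) m x) {k : ℕ}
    (hk : k ≤ m) : k * a ≤ birkhoffSum f φ k (f^[m - k] x) := by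
  have := h (m - k) k (Nat.sub_add_cancel hk)
  rw [birkhoffSum_sub_const] at this
  linarith

theorem birkhoffSum_iterate_of_isPeriodicPt (hx : Function.IsPeriodicPt f m x) (j : ℕ) :
    birkhoffSum f φ m (f^[j] x) = birkhoffSum f φ m x := by
  rw [birkhoffSum_iterate_eq_sub, add_comm, birkhoffSum_add, hx.eq, add_sub_cancel_right]

theorem birkhoffSum_lt_of_dvd (hx : Function.IsPeriodicPt f m x) (hdvd : m ∣ τ) {a : ℝ}
    (h : birkhoffSum f φ τ x < τ * a) : birkhoffSum f φ m x < m * a := by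
  obtain ⟨d, rfl⟩ := hdvd
  have hd := birkhoffSum_mul_add (φ := φ) hx d 0
  rw [add_zero, birkhoffSum_zero, add_zero, mul_comm] at hd
  rw [hd, Nat.cast_mul, mul_comm (m : ℝ), mul_assoc] at h
  exact lt_of_mul_lt_mul_left h d.cast_nonneg

theorem lt_of_isPeriodicPt_of_birkhoffSum_lt {a : ℝ} (hm : 0 < m)
    (hx : Function.IsPeriodicPt f m x) (hsum : m * a ≤ birkhoffSum f φ m x) {j T : ℕ}
    (hj : ∀ k : ℕ, 1 ≤ k → k ≤ T → birkhoffSum f φ k (f^[j] x) < k * a) : T < m := by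
  by_contra! hmT
  have := hj m hm hmT
  rw [birkhoffSum_iterate_of_isPeriodicPt hx] at this
  linarith

theorem sum_Icc_iterate_sub {k : ℕ} (hk : k ≤ m) :
    ∑ i ∈ Finset.Icc 1 k, φ (f^[m - i] x) = birkhoffSum f φ k (f^[m - k] x) := by
  rw [birkhoffSum, ← Finset.sum_range_reflect, ← Finset.Ico_add_one_right_eq_Icc,
    Finset.sum_Ico_eq_sum_range]
  refine Finset.sum_congr rfl fun i hi => ?_
  have hik : i < k := by simpa using hi
  rw [← Function.iterate_add_apply]
  congr 2
  omega

theorem tendsto_birkhoffAverage_of_isPeriodicPt (hm : 0 < m) (hx : Function.IsPeriodicPt f m x) :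
    Tendsto (birkhoffAverage ℝ f φ · x) atTop (𝓝 (birkhoffAverage ℝ f φ m x)) := by
  set A := birkhoffAverage ℝ f φ m x with hA
  have hm0 : (m : ℝ) ≠ 0 := by exact_mod_cast hm.ne'
  have hperiod : birkhoffSum f (φ · - A) m x = 0 := by
    rw [birkhoffSum_sub_const, hA, birkhoffAverage, smul_eq_mul, mul_inv_cancel_left₀ hm0, sub_self]
  have hmod (k : ℕ) : birkhoffSum f (φ · - A) k x = birkhoffSum f (φ · - A) (k % m) x := by
    conv_lhs => rw [← Nat.div_add_mod' k m, birkhoffSum_mul_add hx, hperiod, mul_zero, zero_add]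
  have hbound (k : ℕ) : |birkhoffSum f (φ · - A) k x| ≤
      ∑ i ∈ Finset.range m, |birkhoffSum f (φ · - A) i x| := by
    rw [hmod]
    exact Finset.single_le_sum (f := fun i => |birkhoffSum f (φ · - A) i x|)
      (fun _ _ => abs_nonneg _) (Finset.mem_range.2 (Nat.mod_lt _ hm))
  have hzero : Tendsto (fun k : ℕ => birkhoffSum f (φ · - A) k x / k) atTop (𝓝 0) :=
    squeeze_zero_norm (fun k => by rw [norm_div, Real.norm_natCast]; gcongr; exact hbound k)
      (tendsto_const_div_atTop_nhds_zero_nat _)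
  rw [← tendsto_sub_nhds_zero_iff]
  refine hzero.congr' ?_
  filter_upwards [eventually_ne_atTop 0] with k hk
  rw [birkhoffSum_sub_const, birkhoffAverage, smul_eq_mul]
  field_simp

theorem mul_le_birkhoffSum_of_le_limsup (hm : 0 < m) (hx : Function.IsPeriodicPt f m x) {c : ℝ}
    (h : c ≤ limsup (birkhoffAverage ℝ f φ · x) atTop) : m * c ≤ birkhoffSum f φ m x := by
  rwa [(tendsto_birkhoffAverage_of_isPeriodicPt hm hx).limsup_eq, birkhoffAverage, smul_eq_mul,
    le_inv_mul_iff₀ (by exact_mod_cast hm)] at h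

end PeriodicOrbits

section UniformGrowth

variable {X : Type*} {f : X → X} {φ ψ : X → ℝ} {K : Set X}

theorem neg_mul_le_birkhoffSum {N : ℕ} {B : ℝ} (hfK : MapsTo f K K) (hB : ∀ x ∈ K, |ψ x| ≤ B)
    (h : ∀ x ∈ K, ∃ k, 1 ≤ k ∧ k ≤ N ∧ 0 ≤ birkhoffSum f ψ k x) (k : ℕ) {x : X} (hx : x ∈ K) :
    -(N * B) ≤ birkhoffSum f ψ k x := by
  induction k using Nat.strong_induction_on generalizing x with
  | _ k ih =>
    rcases le_or_gt k N with hkN | hkN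
    · have hB0 : 0 ≤ B := (abs_nonneg _).trans (hB x hx)
      calc -(N * B) ≤ -(k * B) := by gcongr
        _ = birkhoffSum f (fun _ => -B) k x := by simp [birkhoffSum]
        _ ≤ birkhoffSum f ψ k x := birkhoffSum_le_birkhoffSum fun i _ =>
          (abs_le.1 (hB _ (hfK.iterate i hx))).1
    · obtain ⟨l, hl1, hlN, hl⟩ := h x hx
      obtain ⟨r, rfl⟩ := Nat.exists_eq_add_of_le (hlN.trans hkN.le)
      rw [birkhoffSum_add]
      linarith [ih r (by omega) (hfK.iterate l hx)]

variable [TopologicalSpace X]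

theorem exists_bound_birkhoffSum_pos (hf : Continuous f) (hK : IsCompact K) (hfK : MapsTo f K K)
    (hψ : ∀ x ∈ K, ContinuousAt ψ x) (h : ∀ x ∈ K, ∃ k, 1 ≤ k ∧ 0 < birkhoffSum f ψ k x) :
    ∃ N, ∀ x ∈ K, ∃ k, 1 ≤ k ∧ k ≤ N ∧ 0 < birkhoffSum f ψ k x := by
  choose! k hk1 hk using h
  have hopen : ∀ x ∈ K, ∀ᶠ y in 𝓝 x, 0 < birkhoffSum f ψ (k x) y := fun x hx =>
    (continuousAt_birkhoffSum hf (fun i => hψ _ (hfK.iterate i hx)) (k x)).eventually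
      (lt_mem_nhds (hk x hx))
  obtain ⟨t, htK, ht⟩ := hK.elim_nhds_subcover _ hopen
  refine ⟨t.sup k, fun y hy => ?_⟩
  obtain ⟨x, hxt, hxy⟩ := mem_iUnion₂.1 (ht hy)
  exact ⟨k x, hk1 x (htK x hxt), Finset.le_sup hxt, hxy⟩

theorem exists_forall_mul_sub_le_birkhoffSum (hf : Continuous f) (hK : IsCompact K)
    (hfK : MapsTo f K K) (hφ : ∀ x ∈ K, ContinuousAt φ x) {a : ℝ}
    (h : ∀ x ∈ K, ∃ k : ℕ, 1 ≤ k ∧ k * a < birkhoffSum f φ k x) :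
    ∃ D : ℝ, ∀ x ∈ K, ∀ k : ℕ, k * a - D ≤ birkhoffSum f φ k x := by
  have hψ : ∀ x ∈ K, ContinuousAt (φ · - a) x := fun x hx => (hφ x hx).sub_const a
  obtain ⟨N, hN⟩ := exists_bound_birkhoffSum_pos hf hK hfK hψ fun x hx => by
    simpa only [birkhoffSum_sub_const, sub_pos] using h x hx
  obtain ⟨B, hB⟩ := hK.exists_bound_of_continuousOn fun x hx => (hψ x hx).continuousWithinAt
  refine ⟨N * B, fun x hx k => ?_⟩
  have := neg_mul_le_birkhoffSum hfK hB
    (fun x hx => (hN x hx).imp fun _ hk => ⟨hk.1, hk.2.1, hk.2.2.le⟩) k hx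
  rw [birkhoffSum_sub_const] at this
  linarith

end UniformGrowth

section Conorm

variable {E F : Type*} [NormedAddCommGroup E] [NormedSpace ℝ E] [NormedAddCommGroup F]
  [NormedSpace ℝ F]

theorem conorm_mul_norm_le (T : E →L[ℝ] F) (v : E) : conorm T * ‖v‖ ≤ ‖T v‖ := by
  rcases eq_or_ne v 0 with rfl | hv
  · simp
  have hbdd : BddBelow ((fun v : E => ‖T v‖) '' Metric.sphere (0 : E) 1) :=
    ⟨0, by rintro _ ⟨w, -, rfl⟩; exact norm_nonneg _⟩
  have hle : conorm T ≤ ‖T (‖v‖⁻¹ • v)‖ :=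
    csInf_le hbdd (mem_image_of_mem _ (by simp [norm_smul, hv]))
  rwa [map_smul, norm_smul, norm_inv, norm_norm, le_inv_mul_iff₀ (norm_pos_iff.2 hv),
    mul_comm] at hle

theorem conorm_pos_iff_injective [FiniteDimensional ℝ E] [Nontrivial E] {T : E →L[ℝ] F} :
    0 < conorm T ↔ Function.Injective T := by
  refine ⟨fun hT => (injective_iff_map_eq_zero T).2 fun v hv => ?_, fun hT => ?_⟩
  · have hle := conorm_mul_norm_le T v
    rw [hv, norm_zero] at hle
    exact norm_le_zero_iff.1 (nonpos_of_mul_nonpos_right hle hT)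
  · have : ProperSpace E := FiniteDimensional.proper ℝ E
    obtain ⟨v, hv, hmin⟩ := ((isCompact_sphere (0 : E) 1).image T.continuous.norm).sInf_mem
      ((NormedSpace.sphere_nonempty.2 zero_le_one).image _)
    have hv0 : v ≠ 0 := ne_zero_of_mem_unit_sphere ⟨v, hv⟩
    rw [conorm, ← hmin]
    exact norm_pos_iff.2 ((map_ne_zero_iff T hT).2 hv0)

theorem conorm_eq_sInf_div {G : Type*} [NormedAddCommGroup G] [NormedSpace ℝ G]
    (T : E →L[ℝ] F) (e : G ≃L[ℝ] E) :
    conorm T = sInf ((fun v : G => ‖T (e v)‖ / ‖e v‖) '' Metric.sphere (0 : G) 1) := by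
  unfold conorm
  congr 1
  ext r
  constructor
  · rintro ⟨v, hv, rfl⟩
    have hv1 : ‖v‖ = 1 := by simpa using hv
    have hv0 : e.symm v ≠ 0 :=
      e.symm.map_ne_zero_iff.2 (ne_zero_of_mem_unit_sphere ⟨v, hv⟩)
    refine ⟨‖e.symm v‖⁻¹ • e.symm v, by simp [norm_smul, hv0], ?_⟩
    have hw : ‖e.symm v‖ ≠ 0 := norm_ne_zero_iff.2 hv0
    simp only [map_smul, e.apply_symm_apply, norm_smul, norm_inv, norm_norm, hv1]
    field_simp
  · rintro ⟨v, hv, rfl⟩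
    have hv0 : e v ≠ 0 := e.map_ne_zero_iff.2 (ne_zero_of_mem_unit_sphere ⟨v, hv⟩)
    refine ⟨‖e v‖⁻¹ • e v, by simp [norm_smul, hv0], ?_⟩
    simp only [map_smul, norm_smul, norm_inv, norm_norm, div_eq_inv_mul]

end Conorm

section RiemannianBundle

theorem isContinuousRiemannianBundle_of_isContMDiffRiemannianBundle {EB HB B : Type*}
    [NormedAddCommGroup EB] [NormedSpace ℝ EB] [TopologicalSpace HB] (I : ModelWithCorners ℝ EB HB)
    (r : WithTop ℕ∞) [TopologicalSpace B] [ChartedSpace HB B] (F : Type*) [NormedAddCommGroup F]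
    [NormedSpace ℝ F] (E : B → Type*) [TopologicalSpace (TotalSpace F E)]
    [∀ x, NormedAddCommGroup (E x)] [∀ x, InnerProductSpace ℝ (E x)] [FiberBundle F E]
    [VectorBundle ℝ F E] [IsContMDiffRiemannianBundle I r F E] :
    IsContinuousRiemannianBundle F E := by
  obtain ⟨g, hg, hinner⟩ := IsContMDiffRiemannianBundle.exists_contMDiff (IB := I) (n := r)
    (F := F) (E := E)
  exact ⟨g, hg.continuous, hinner⟩

variable {B : Type*} [TopologicalSpace B] {F : Type*} [NormedAddCommGroup F] [NormedSpace ℝ F]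
  {E : B → Type*} [TopologicalSpace (TotalSpace F E)] [∀ x, TopologicalSpace (E x)]
  [∀ x, AddCommGroup (E x)] [∀ x, Module ℝ (E x)] [FiberBundle F E]

theorem continuous_continuousLinearEquivAt_symm (e : Trivialization F (π F E)) [e.IsLinear ℝ] :
    Continuous fun z : e.baseSet × F =>
      (⟨z.1, (e.continuousLinearEquivAt ℝ z.1 z.1.2).symm z.2⟩ : TotalSpace F E) := by
  have hsymm : Continuous fun z : e.baseSet × F =>
      e.toOpenPartialHomeomorph.symm ((z.1 : B), z.2) :=
    e.toOpenPartialHomeomorph.continuousOn_symm.comp_continuous (by fun_prop) fun z => by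
      rw [e.target_eq]
      exact ⟨z.1.2, mem_univ _⟩
  exact hsymm.congr fun z => e.symm_apply_eq_mk_continuousLinearEquivAt_symm _ z.1.2 _

variable [∀ x, IsTopologicalAddGroup (E x)] [∀ x, ContinuousConstSMul ℝ (E x)]
  [VectorBundle ℝ F E] [RiemannianBundle E] [IsContinuousRiemannianBundle F E]

variable (F E) in
theorem continuous_norm_totalSpace : Continuous fun v : TotalSpace F E => ‖v.2‖ := by
  have hinner : Continuous fun v : TotalSpace F E => inner ℝ v.2 v.2 :=
    Continuous.inner_bundle (b := TotalSpace.proj) (v := TotalSpace.snd) (w := TotalSpace.snd)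
      continuous_id continuous_id
  simpa only [real_inner_self_eq_norm_sq, Real.sqrt_sq (norm_nonneg _)] using hinner.sqrt

theorem continuous_conorm_of_continuous_norm [FiniteDimensional ℝ F] {G : B → Type*}
    [∀ x, NormedAddCommGroup (G x)] [∀ x, NormedSpace ℝ (G x)] {T : ∀ x, E x →L[ℝ] G x}
    (hT : Continuous fun v : TotalSpace F E => ‖T v.1 v.2‖) : Continuous fun x => conorm (T x) := by
  have : ProperSpace F := FiniteDimensional.proper ℝ F
  refine continuous_iff_continuousAt.2 fun x₀ => ?_
  set e := trivializationAt F E x₀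
  have hsymm := (continuous_continuousLinearEquivAt_symm e).comp
    (Continuous.prodMap continuous_id (continuous_subtype_val (p := (· ∈ Metric.sphere (0 : F) 1))))
  have hratio := (hT.comp hsymm).div ((continuous_norm_totalSpace F E).comp hsymm) fun z =>
    norm_ne_zero_iff.2 ((e.continuousLinearEquivAt ℝ _ z.1.2).symm.map_ne_zero_iff.2
      (ne_zero_of_mem_unit_sphere z.2))
  have hcont : Continuous fun x : e.baseSet => conorm (T x) := by
    refine (isCompact_univ.continuous_sInf
      (f := fun (x : e.baseSet) (v : Metric.sphere (0 : F) 1) =>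
        ‖T x ((e.continuousLinearEquivAt ℝ x.1 x.2).symm v)‖ /
          ‖(e.continuousLinearEquivAt ℝ x.1 x.2).symm v‖) hratio).congr fun x => ?_
    rw [conorm_eq_sInf_div _ (e.continuousLinearEquivAt ℝ x.1 x.2).symm, image_univ, image_eq_range]
  exact (continuousOn_iff_continuous_domRestrict.2 hcont).continuousAt
    (e.open_baseSet.mem_nhds (FiberBundle.mem_baseSet_trivializationAt' x₀))

end RiemannianBundle

section InverseFunction

variable {E : Type*} [NormedAddCommGroup E] [NormedSpace ℝ E] {H : Type*} [TopologicalSpace H]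
  {I : ModelWithCorners ℝ E H} {M : Type*} [TopologicalSpace M] [ChartedSpace H M]
  {F : Type*} [NormedAddCommGroup F] [NormedSpace ℝ F] {G : Type*} [TopologicalSpace G]
  {J : ModelWithCorners ℝ F G} {N : Type*} [TopologicalSpace N] [ChartedSpace G N]

theorem exists_contDiffAt_writtenInExtChartAt_inverse [CompleteSpace E] [I.Boundaryless]
    {f : M → N} {x₀ : M} (hf : ContMDiffAt I J 1 f x₀) (hinv : (mfderiv I J f x₀).IsInvertible) :
    ∃ g : F → E, ContDiffAt ℝ 1 g (extChartAt J (f x₀) (f x₀)) ∧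
      (∀ᶠ z in 𝓝 (extChartAt J (f x₀) (f x₀)), writtenInExtChartAt I J x₀ f (g z) = z) ∧
      ∀ᶠ a in 𝓝 (extChartAt I x₀ x₀), g (writtenInExtChartAt I J x₀ f a) = a := by
  have hF : ContDiffAt ℝ 1 (writtenInExtChartAt I J x₀ f) (extChartAt I x₀ x₀) := by
    have := (contMDiffAt_iff.1 hf).2
    rwa [ModelWithCorners.Boundaryless.range_eq_univ, contDiffWithinAt_univ] at this
  obtain ⟨A, hA⟩ : ∃ A : E ≃L[ℝ] F,
      HasFDerivAt (writtenInExtChartAt I J x₀ f) (A : E →L[ℝ] F) (extChartAt I x₀ x₀) := by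
    obtain ⟨A₀, hA₀, A, rfl⟩ : ∃ A₀ : E →L[ℝ] F, HasFDerivWithinAt (writtenInExtChartAt I J x₀ f)
        A₀ (range I) (extChartAt I x₀ x₀) ∧ A₀.IsInvertible :=
      ⟨mfderiv I J f x₀, (hf.mdifferentiableAt one_ne_zero).hasMFDerivAt.2, hinv⟩
    rw [ModelWithCorners.Boundaryless.range_eq_univ, hasFDerivWithinAt_univ] at hA₀
    exact ⟨A, hA₀⟩
  have hstrict := hF.hasStrictFDerivAt' hA one_ne_zero
  have hx₀ : writtenInExtChartAt I J x₀ f (extChartAt I x₀ x₀) = extChartAt J (f x₀) (f x₀) := by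
    simp [writtenInExtChartAt]
  rw [← hx₀]
  exact ⟨_, hF.to_localInverse hA one_ne_zero, hstrict.eventually_right_inverse,
    hstrict.eventually_left_inverse⟩

theorem exists_contMDiffAt_local_inverse [CompleteSpace E] [I.Boundaryless] [IsManifold I 1 M]
    [IsManifold J 1 N] {f : M → N} {x₀ : M} (hf : ContMDiffAt I J 1 f x₀)
    (hinv : (mfderiv I J f x₀).IsInvertible) :
    ∃ g : N → M, ContMDiffAt J I 1 g (f x₀) ∧ g (f x₀) = x₀ ∧
      (∀ᶠ y in 𝓝 (f x₀), f (g y) = y) ∧ ∀ᶠ x in 𝓝 x₀, g (f x) = x := by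
  obtain ⟨g, hg, hright, hleft⟩ := exists_contDiffAt_writtenInExtChartAt_inverse hf hinv
  set ψ := extChartAt I x₀
  set χ := extChartAt J (f x₀)
  have hgx : g (χ (f x₀)) = ψ x₀ := by
    simpa [writtenInExtChartAt, ψ, χ] using hleft.self_of_nhds
  have hfix : (ψ.symm ∘ g ∘ χ) (f x₀) = x₀ := by
    simp only [Function.comp_apply, hgx, ψ, extChartAt_to_inv]
  have hdiff : ContMDiffAt J I 1 (ψ.symm ∘ g ∘ χ) (f x₀) := by
    refine ContMDiffAt.comp (I' := 𝓘(ℝ, E)) (f x₀) ?_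
      (hg.contMDiffAt.comp (f x₀) contMDiffAt_extChartAt)
    rw [Function.comp_apply, hgx]
    exact (contMDiffOn_extChartAt_symm x₀).contMDiffAt (extChartAt_target_mem_nhds x₀)
  refine ⟨ψ.symm ∘ g ∘ χ, hdiff, hfix, ?_, ?_⟩
  · have hsource : ∀ᶠ y in 𝓝 (f x₀), f ((ψ.symm ∘ g ∘ χ) y) ∈ χ.source := by
      refine (ContinuousAt.comp (g := f) ?_ hdiff.continuousAt).eventually_mem ?_
      · rw [hfix]
        exact hf.continuousAt
      · rw [Function.comp_apply, hfix]
        exact extChartAt_source_mem_nhds _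
    filter_upwards [(continuousAt_extChartAt (f x₀)).eventually hright, hsource,
      extChartAt_source_mem_nhds (I := J) (f x₀)] with y hy hfy hy'
    exact χ.injOn hfy hy' hy
  · filter_upwards [(continuousAt_extChartAt x₀).eventually hleft,
      extChartAt_source_mem_nhds (I := I) x₀] with x hx hx'
    simp only [writtenInExtChartAt, Function.comp_apply] at hx
    rw [ψ.left_inv hx'] at hx
    simp only [Function.comp_apply]
    rw [hx, ψ.left_inv hx']

end InverseFunction

section RiemannianManifold

variable {E : Type*} [NormedAddCommGroup E] [NormedSpace ℝ E] {H : Type*} [TopologicalSpace H]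
  {I : ModelWithCorners ℝ E H} {M : Type*} [TopologicalSpace M] [ChartedSpace H M]
  [RiemannianBundle (fun x : M => TangentSpace I x)]
  {F : Type*} [NormedAddCommGroup F] [NormedSpace ℝ F] {G : Type*} [TopologicalSpace G]
  {J : ModelWithCorners ℝ F G} {N : Type*} [TopologicalSpace N] [ChartedSpace G N]
  [RiemannianBundle (fun x : N => TangentSpace J x)]

theorem continuous_conorm_mfderiv [FiniteDimensional ℝ E] [IsManifold I 1 M] [IsManifold J 1 N]
    [IsContinuousRiemannianBundle E (fun x : M => TangentSpace I x)]
    [IsContinuousRiemannianBundle F (fun x : N => TangentSpace J x)] {f : M → N}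
    (hf : ContMDiff I J 1 f) : Continuous fun x => conorm (mfderiv I J f x) :=
  continuous_conorm_of_continuous_norm (F := E) (E := fun x : M => TangentSpace I x)
    ((continuous_norm_totalSpace F (fun x : N => TangentSpace J x)).comp
      (hf.continuous_tangentMap le_rfl))

theorem norm_tangentSpace_congr {x y : N} (h : x = y) (v : F) :
    @norm (TangentSpace J x) _ v = @norm (TangentSpace J y) _ v := by
  rw [h]

theorem conorm_mul_norm_mfderiv_rightInverse_le {f : M → N} {g : N → M} {y : N}
    (hf : MDifferentiableAt I J f (g y)) (hg : MDifferentiableAt J I g y)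
    (hfg : ∀ᶠ z in 𝓝 y, f (g z) = z) (v : TangentSpace J y) :
    conorm (mfderiv I J f (g y)) * ‖mfderiv J I g y v‖ ≤ ‖v‖ := by
  have hid : HasMFDerivAt J J id y ((mfderiv I J f (g y)) ∘L (mfderiv J I g y)) :=
    (hf.hasMFDerivAt.comp y hg.hasMFDerivAt).congr_of_eventuallyEq (EventuallyEq.symm hfg)
  have hv : mfderiv I J f (g y) (mfderiv J I g y v) = (v : F) :=
    congrArg (fun A : F →L[ℝ] F => A v) (hasMFDerivAt_unique hid (hasMFDerivAt_id y))
  refine (conorm_mul_norm_le (mfderiv I J f (g y)) (mfderiv J I g y v)).trans_eq ?_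
  rw [hv]
  exact norm_tangentSpace_congr (J := J) hfg.self_of_nhds v

end RiemannianManifold

section Lipschitz

variable {E : Type*} [NormedAddCommGroup E] [NormedSpace ℝ E] {H : Type*} [TopologicalSpace H]
  {I : ModelWithCorners ℝ E H} {M : Type*}
  {F : Type*} [NormedAddCommGroup F] [NormedSpace ℝ F] {G : Type*} [TopologicalSpace G]
  {J : ModelWithCorners ℝ F G} {N : Type*}

theorem pathELength_comp_le [TopologicalSpace M] [ChartedSpace H M] [TopologicalSpace N]
    [ChartedSpace G N] [∀ x : M, ENorm (TangentSpace I x)] [∀ x : N, ENorm (TangentSpace J x)]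
    {g : M → N} {L : NNReal} {γ : ℝ → M} {a b : ℝ} (hab : a < b)
    (hγ : MDifferentiableOn 𝓘(ℝ, ℝ) I γ (Icc a b))
    (hg : ∀ t ∈ Icc a b, MDifferentiableAt I J g (γ t))
    (hL : ∀ t ∈ Icc a b, ∀ v : TangentSpace I (γ t), ‖mfderiv I J g (γ t) v‖ₑ ≤ L * ‖v‖ₑ) :
    pathELength J (g ∘ γ) a b ≤ L * pathELength I γ a b := by
  rw [pathELength_eq_lintegral_mfderivWithin_Icc, pathELength_eq_lintegral_mfderivWithin_Icc,
    ← MeasureTheory.lintegral_const_mul' _ _ ENNReal.coe_ne_top]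
  refine MeasureTheory.setLIntegral_mono' measurableSet_Icc fun t ht => ?_
  have hchain : mfderivWithin 𝓘(ℝ, ℝ) J (g ∘ γ) (Icc a b) t 1 =
      mfderiv I J g (γ t) (mfderivWithin 𝓘(ℝ, ℝ) I γ (Icc a b) t 1) := by
    rw [mfderiv_comp_mfderivWithin t (hg t ht) (hγ t ht)
      ((uniqueDiffOn_Icc hab t ht).uniqueMDiffWithinAt)]
    rfl
  rw [hchain]
  exact hL t ht _

variable [PseudoEMetricSpace M] [ChartedSpace H M]
  [RiemannianBundle (fun x : M => TangentSpace I x)] [IsRiemannianManifold I M]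

theorem exists_path_mapsTo_eball [IsManifold I 1 M] {b y z : M} {r R : ENNReal}
    (hy : y ∈ Metric.eball b r) (hR : edist y z < R) :
    ∃ γ : ℝ → M, γ 0 = y ∧ γ 1 = z ∧ ContMDiffOn 𝓘(ℝ, ℝ) I 1 γ (Icc 0 1) ∧
      MapsTo γ (Icc 0 1) (Metric.eball b (r + R)) ∧ pathELength I γ 0 1 < R := by
  rw [IsRiemannianManifold.out (I := I) y z] at hR
  obtain ⟨γ, h0, h1, hγ, hlen⟩ := exists_lt_of_riemannianEDist_lt hR
  refine ⟨γ, h0, h1, hγ, fun t ht => ?_, hlen⟩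
  have hyt : edist y (γ t) < R := calc
    edist y (γ t) = riemannianEDist I y (γ t) := IsRiemannianManifold.out _ _
    _ ≤ pathELength I γ 0 t :=
      riemannianEDist_le_pathELength (hγ.mono (Icc_subset_Icc_right ht.2)) h0 rfl ht.1
    _ ≤ pathELength I γ 0 1 := pathELength_mono le_rfl ht.2
    _ < R := hlen
  rw [Metric.mem_eball'] at hy ⊢
  exact (edist_triangle b y (γ t)).trans_lt (ENNReal.add_lt_add hy hyt)

variable [PseudoEMetricSpace N] [ChartedSpace G N]
  [RiemannianBundle (fun x : N => TangentSpace J x)] [IsRiemannianManifold J N]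

theorem lipschitzOnWith_of_enorm_mfderiv_le [IsManifold I 1 M] [IsManifold J 1 N]
    {g : M → N} {L : NNReal} {b : M} {r : ENNReal}
    (hg : ContMDiffOn I J 1 g (Metric.eball b (3 * r)))
    (hL : ∀ y ∈ Metric.eball b (3 * r), ∀ v : TangentSpace I y,
      ‖mfderiv I J g y v‖ₑ ≤ L * ‖v‖ₑ) :
    LipschitzOnWith L g (Metric.eball b r) := by
  intro y hy z hz
  have hyz : edist y z < r + r :=
    (edist_triangle_right y z b).trans_lt (ENNReal.add_lt_add hy hz)
  have : (𝓝[>] edist y z).NeBot := nhdsGT_neBot_of_exists_gt ⟨_, hyz⟩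
  have hlim : Tendsto (fun R : ENNReal => L * R) (𝓝[>] edist y z) (𝓝 (L * edist y z)) :=
    (ENNReal.Tendsto.const_mul tendsto_id (Or.inr ENNReal.coe_ne_top)).mono_left
      nhdsWithin_le_nhds
  refine ge_of_tendsto hlim ?_
  filter_upwards [Ioo_mem_nhdsGT hyz] with R hR
  obtain ⟨γ, h0, h1, hγ, hmaps, hlen⟩ := exists_path_mapsTo_eball (I := I) hy hR.1
  have hball : Metric.eball b (r + R) ⊆ Metric.eball b (3 * r) :=
    Metric.eball_subset_eball <| calc
      r + R ≤ r + (r + r) := by gcongr; exact hR.2.le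
      _ = 3 * r := by ring
  have hin := hmaps.mono_right hball
  calc edist (g y) (g z) = riemannianEDist J (g y) (g z) := IsRiemannianManifold.out _ _
    _ ≤ pathELength J (g ∘ γ) 0 1 :=
      riemannianEDist_le_pathELength (hg.comp hγ hin) (by simp [h0]) (by simp [h1]) zero_le_one
    _ ≤ L * pathELength I γ 0 1 :=
      pathELength_comp_le zero_lt_one (hγ.mdifferentiableOn one_ne_zero)
        (fun t ht => (hg.contMDiffAt (Metric.isOpen_eball.mem_nhds (hin ht))).mdifferentiableAt
          one_ne_zero) fun t ht => hL _ (hin ht)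
    _ ≤ L * R := by gcongr

end Lipschitz

section LocalInverse

variable {E : Type*} [NormedAddCommGroup E] [NormedSpace ℝ E] [FiniteDimensional ℝ E]
  {H : Type*} [TopologicalSpace H] {I : ModelWithCorners ℝ E H} [I.Boundaryless]
  {M : Type*} [PseudoEMetricSpace M] [ChartedSpace H M] [IsManifold I 1 M]
  [RiemannianBundle (fun x : M => TangentSpace I x)]
  [IsContinuousRiemannianBundle E (fun x : M => TangentSpace I x)] [IsRiemannianManifold I M]
  {F : Type*} [NormedAddCommGroup F] [NormedSpace ℝ F] {G : Type*} [TopologicalSpace G]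
  {J : ModelWithCorners ℝ F G} {N : Type*} [PseudoEMetricSpace N] [ChartedSpace G N]
  [IsManifold J 1 N] [RiemannianBundle (fun x : N => TangentSpace J x)]
  [IsContinuousRiemannianBundle F (fun x : N => TangentSpace J x)] [IsRiemannianManifold J N]

theorem exists_lipschitzOnWith_local_inverse {f : M → N} (hf : ContMDiff I J 1 f) {x₀ : M}
    (hinv : (mfderiv I J f x₀).IsInvertible) {a : ℝ} (ha : 0 < a)
    (hax : a < conorm (mfderiv I J f x₀)) :
    ∃ g : N → M, ∃ r > 0, LipschitzOnWith a⁻¹.toNNReal g (Metric.eball (f x₀) r) ∧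
      RightInvOn g f (Metric.eball (f x₀) r) ∧ ∀ᶠ x in 𝓝 x₀, g (f x) = x := by
  have : CompleteSpace E := FiniteDimensional.complete ℝ E
  obtain ⟨g, hg, hgx, hfg, hgf⟩ := exists_contMDiffAt_local_inverse hf.contMDiffAt hinv
  obtain ⟨u, hu, hgu⟩ := (contMDiffAt_iff_contMDiffOn_nhds (by simp)).1 hg
  have hconorm : ∀ᶠ y in 𝓝 (f x₀), a < conorm (mfderiv I J f (g y)) := by
    refine ((continuous_conorm_mfderiv hf).continuousAt.comp hg.continuousAt).eventually
      (lt_mem_nhds ?_)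
    rwa [Function.comp_apply, hgx]
  obtain ⟨R, hR, hsub⟩ := EMetric.mem_nhds_iff.1 (inter_mem hu (hfg.and hconorm))
  have hR3 : 3 * (R / 3) ≤ R := ENNReal.mul_div_le
  replace hsub := (Metric.eball_subset_eball hR3).trans hsub
  refine ⟨g, R / 3, ENNReal.div_pos hR.ne' (by simp),
    lipschitzOnWith_of_enorm_mfderiv_le (I := J) (J := I) (hgu.mono fun y hy => (hsub hy).1)
      fun y hy v => ?_, fun y hy => ?_, hgf⟩
  · have hnear : Metric.eball (f x₀) (3 * (R / 3)) ∈ 𝓝 y := Metric.isOpen_eball.mem_nhds hy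
    have hle : ‖mfderiv J I g y v‖ ≤ a⁻¹ * ‖v‖ := by
      rw [le_inv_mul_iff₀ ha]
      refine le_trans ?_ (conorm_mul_norm_mfderiv_rightInverse_le
        (hf.mdifferentiable one_ne_zero _)
        (((hgu.mono fun z hz => (hsub hz).1).contMDiffAt hnear).mdifferentiableAt one_ne_zero)
        (mem_of_superset hnear fun z hz => (hsub hz).2.1) v)
      gcongr
      exact (hsub hy).2.2.le
    rw [← ofReal_norm, ← ofReal_norm, ENNReal.ofNNReal_toNNReal,
      ← ENNReal.ofReal_mul (inv_pos.2 ha).le]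
    exact ENNReal.ofReal_le_ofReal hle
  · exact (hsub (Metric.eball_subset_eball (le_mul_of_one_le_left' (by norm_num)) hy)).2.1

end LocalInverse

section CriticalPoint

variable {n : ℕ} {M : Type*} [TopologicalSpace M] [ChartedSpace (EuclideanSpace ℝ (Fin n)) M]
  {f : M → M} {x : M}

theorem not_isCriticalPoint_iff_injective :
    ¬ IsCriticalPoint n f x ↔ Function.Injective (mfderiv (𝓡 n) (𝓡 n) f x) := by
  have hiff : ∀ A : EuclideanSpace ℝ (Fin n) →L[ℝ] EuclideanSpace ℝ (Fin n),
      Function.Surjective A ↔ Function.Injective A :=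
    fun A => (LinearMap.injective_iff_surjective (f := A.toLinearMap)).symm
  exact not_not.trans (hiff _)

theorem isInvertible_mfderiv_of_not_isCriticalPoint (hx : ¬ IsCriticalPoint n f x) :
    (mfderiv (𝓡 n) (𝓡 n) f x).IsInvertible := by
  have hbij : ∀ A : EuclideanSpace ℝ (Fin n) →L[ℝ] EuclideanSpace ℝ (Fin n),
      Function.Bijective A → A.IsInvertible :=
    fun A hA => ⟨(LinearEquiv.ofBijective A.toLinearMap hA).toContinuousLinearEquiv, rfl⟩
  exact hbij _ ⟨not_isCriticalPoint_iff_injective.1 hx, not_not.1 hx⟩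

variable [RiemannianBundle (fun x : M => TangentSpace (𝓡 n) x)]

theorem not_isCriticalPoint_iff_conorm_pos (hn : 1 ≤ n) :
    ¬ IsCriticalPoint n f x ↔ 0 < conorm (mfderiv (𝓡 n) (𝓡 n) f x) := by
  have : NeZero n := ⟨by lia⟩
  have : FiniteDimensional ℝ (TangentSpace (𝓡 n) x) :=
    inferInstanceAs (FiniteDimensional ℝ (EuclideanSpace ℝ (Fin n)))
  have : Nontrivial (TangentSpace (𝓡 n) x) :=
    inferInstanceAs (Nontrivial (EuclideanSpace ℝ (Fin n)))
  rw [not_isCriticalPoint_iff_injective, conorm_pos_iff_injective]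

variable [IsManifold (𝓡 n) ∞ M]

theorem exp_logConorm (hn : 1 ≤ n) (hx : ¬ IsCriticalPoint n f x) :
    Real.exp (logConorm n f x) = conorm (mfderiv (𝓡 n) (𝓡 n) f x) :=
  Real.exp_log ((not_isCriticalPoint_iff_conorm_pos hn).1 hx)

theorem exp_birkhoffSum_mul_norm_le (hn : 1 ≤ n) (hf : ContMDiff (𝓡 n) (𝓡 n) 1 f)
    {K : Set M} (hK : MapsTo f K K) (hcrit : ∀ x ∈ K, ¬ IsCriticalPoint n f x) (k : ℕ)
    (hx : x ∈ K) (v : TangentSpace (𝓡 n) x) :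
    Real.exp (birkhoffSum f (logConorm n f) k x) * ‖v‖ ≤
      ‖mfderiv (𝓡 n) (𝓡 n) (f^[k]) x v‖ := by
  induction k generalizing x with
  | zero =>
    simp only [birkhoffSum_zero, Real.exp_zero, one_mul, Function.iterate_zero, mfderiv_id]
    exact le_rfl
  | succ k ih =>
    have hchain : mfderiv (𝓡 n) (𝓡 n) (f^[k + 1]) x v =
        mfderiv (𝓡 n) (𝓡 n) (f^[k]) (f x) (mfderiv (𝓡 n) (𝓡 n) f x v) := by
      rw [Function.iterate_succ, mfderiv_comp x ((hf.iterate k).mdifferentiable one_ne_zero _)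
        (hf.mdifferentiable one_ne_zero x)]
      rfl
    calc Real.exp (birkhoffSum f (logConorm n f) (k + 1) x) * ‖v‖
        = Real.exp (birkhoffSum f (logConorm n f) k (f x)) *
            (conorm (mfderiv (𝓡 n) (𝓡 n) f x) * ‖v‖) := by
          rw [birkhoffSum_succ', add_comm, Real.exp_add, exp_logConorm hn (hcrit x hx), mul_assoc]
      _ ≤ Real.exp (birkhoffSum f (logConorm n f) k (f x)) * ‖mfderiv (𝓡 n) (𝓡 n) f x v‖ := by
          gcongr
          exact conorm_mul_norm_le (mfderiv (𝓡 n) (𝓡 n) f x) v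
      _ ≤ ‖mfderiv (𝓡 n) (𝓡 n) (f^[k]) (f x) (mfderiv (𝓡 n) (𝓡 n) f x v)‖ := ih (hK hx) _
      _ = ‖mfderiv (𝓡 n) (𝓡 n) (f^[k + 1]) x v‖ := congrArg norm hchain.symm

variable [IsContinuousRiemannianBundle (EuclideanSpace ℝ (Fin n))
  (fun x : M => TangentSpace (𝓡 n) x)]

theorem continuousAt_logConorm (hn : 1 ≤ n) (hf : ContMDiff (𝓡 n) (𝓡 n) 1 f)
    (hx : ¬ IsCriticalPoint n f x) : ContinuousAt (logConorm n f) x := by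
  have : IsManifold (𝓡 n) 1 M := IsManifold.of_le (n := ∞) (by simp)
  exact (continuous_conorm_mfderiv hf).continuousAt.log
    ((not_isCriticalPoint_iff_conorm_pos hn).1 hx).ne'

theorem isOpen_setOf_not_isCriticalPoint (hn : 1 ≤ n) (hf : ContMDiff (𝓡 n) (𝓡 n) 1 f) :
    IsOpen {x | ¬ IsCriticalPoint n f x} := by
  have : IsManifold (𝓡 n) 1 M := IsManifold.of_le (n := ∞) (by simp)
  simp only [not_isCriticalPoint_iff_conorm_pos hn]
  exact isOpen_lt continuous_const (continuous_conorm_mfderiv hf)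

theorem uniformlyExpandingOn_of_lt_birkhoffSum (hn : 1 ≤ n) (hf : ContMDiff (𝓡 n) (𝓡 n) 1 f)
    {K : Set M} (hK : IsCompact K) (hfK : MapsTo f K K)
    (hcrit : ∀ x ∈ K, ¬ IsCriticalPoint n f x) {a : ℝ} (ha : 0 < a)
    (h : ∀ x ∈ K, ∃ k : ℕ, 1 ≤ k ∧ k * a < birkhoffSum f (logConorm n f) k x) :
    UniformlyExpandingOn n f K := by
  obtain ⟨D, hD⟩ := exists_forall_mul_sub_le_birkhoffSum hf.continuous hK hfK
    (fun x hx => continuousAt_logConorm hn hf (hcrit x hx)) h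
  refine ⟨Real.exp (-D), Real.exp_pos _, a, ha, fun x hx v k _ => ?_⟩
  calc Real.exp (-D) * ‖v‖ * Real.exp (k * a)
      = Real.exp (k * a - D) * ‖v‖ := by rw [mul_right_comm, ← Real.exp_add, neg_add_eq_sub]
    _ ≤ Real.exp (birkhoffSum f (logConorm n f) k x) * ‖v‖ := by gcongr; exact hD x hx k
    _ ≤ _ := exp_birkhoffSum_mul_norm_le hn hf hfK hcrit k hx v

end CriticalPoint

section InverseBranches

variable {n : ℕ} {M : Type*} [EMetricSpace M] [ChartedSpace (EuclideanSpace ℝ (Fin n)) M]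
  [IsManifold (𝓡 n) ∞ M] [RiemannianBundle (fun x : M => TangentSpace (𝓡 n) x)]
  [IsContinuousRiemannianBundle (EuclideanSpace ℝ (Fin n)) (fun x : M => TangentSpace (𝓡 n) x)]
  [IsRiemannianManifold (𝓡 n) M] {f : M → M} {ε : ℝ}

theorem exists_mem_nhds_hasInverseBranches (hn : 1 ≤ n) (hf : ContMDiff (𝓡 n) (𝓡 n) 1 f) {x₀ : M}
    (hx₀ : ¬ IsCriticalPoint n f x₀) (hε : 0 < ε) :
    ∃ s ∈ 𝓝 x₀, ∃ ρ, 0 < ρ ∧ HasInverseBranches f (logConorm n f · - ε) s ρ := by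
  have : IsManifold (𝓡 n) 1 M := IsManifold.of_le (n := ∞) (by simp)
  obtain ⟨g, r, hr, hlip, hright, hleft⟩ := exists_lipschitzOnWith_local_inverse hf
    (isInvertible_mfderiv_of_not_isCriticalPoint hx₀)
    (a := Real.exp (logConorm n f x₀ - ε / 2)) (Real.exp_pos _)
    (by rw [← exp_logConorm hn hx₀, Real.exp_lt_exp]; linarith)
  have hrate : ∀ᶠ x in 𝓝 x₀, logConorm n f x < logConorm n f x₀ + ε / 2 :=
    (continuousAt_logConorm hn hf hx₀).eventually (gt_mem_nhds (by linarith))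
  obtain ⟨ρ, hρ, hρr⟩ : ∃ ρ, 0 < ρ ∧ ρ + ρ < r := by
    obtain ⟨d, hd, hdr⟩ := exists_between hr
    exact ⟨d / 2, ENNReal.half_pos hd.ne', by rwa [ENNReal.add_halves]⟩
  have hnear : ∀ᶠ x in 𝓝 x₀, f x ∈ Metric.eball (f x₀) ρ :=
    hf.continuous.continuousAt.eventually_mem (Metric.eball_mem_nhds _ hρ)
  refine ⟨_, hrate.and (hnear.and hleft), ρ, hρ, fun x ⟨hxrate, hxnear, hxleft⟩ => ?_⟩
  have hball : Metric.closedEBall (f x) ρ ⊆ Metric.eball (f x₀) r := fun y hy =>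
    calc edist y (f x₀) ≤ edist y (f x) + edist (f x) (f x₀) := edist_triangle _ _ _
      _ ≤ ρ + ρ := add_le_add hy (le_of_lt hxnear)
      _ < r := hρr
  refine ⟨g, hxleft, (hlip.mono hball).weaken (Real.toNNReal_le_toNNReal ?_), hright.mono hball⟩
  rw [← Real.exp_neg, Real.exp_le_exp]
  linarith

theorem exists_hasInverseBranches (hn : 1 ≤ n) (hf : ContMDiff (𝓡 n) (𝓡 n) 1 f) {K : Set M}
    (hK : IsCompact K) (hcrit : ∀ x ∈ K, ¬ IsCriticalPoint n f x) (hε : 0 < ε) :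
    ∃ ρ, 0 < ρ ∧ HasInverseBranches f (logConorm n f · - ε) K ρ := by
  refine hK.induction_on (p := fun s => ∃ ρ, 0 < ρ ∧ HasInverseBranches f (logConorm n f · - ε) s ρ)
    ⟨1, one_pos, fun _ h => h.elim⟩ ?_ ?_ ?_
  · rintro s t hst ⟨ρ, hρ, h⟩
    exact ⟨ρ, hρ, h.mono hst le_rfl⟩
  · rintro s t ⟨ρ, hρ, h⟩ ⟨ρ', hρ', h'⟩
    exact ⟨min ρ ρ', lt_min hρ hρ',
      (h.mono Subset.rfl (min_le_left _ _)).union (h'.mono Subset.rfl (min_le_right _ _))⟩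
  · intro x hx
    obtain ⟨s, hs, h⟩ := exists_mem_nhds_hasInverseBranches hn hf (hcrit x hx) hε
    exact ⟨s, mem_nhdsWithin_of_mem_nhds hs, h⟩

end InverseBranches

section PeriodicOrbits

variable {n : ℕ} {M : Type*} [EMetricSpace M] [ChartedSpace (EuclideanSpace ℝ (Fin n)) M]
  [IsManifold (𝓡 n) ∞ M] [RiemannianBundle (fun x : M => TangentSpace (𝓡 n) x)]
  [IsContinuousRiemannianBundle (EuclideanSpace ℝ (Fin n)) (fun x : M => TangentSpace (𝓡 n) x)]
  [IsRiemannianManifold (𝓡 n) M] {f : M → M}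

theorem exists_mem_periodicPts_of_slow_point (hn : 1 ≤ n) (hf : ContMDiff (𝓡 n) (𝓡 n) 1 f)
    {Lam V : Set M} (hK : IsCompact (closure Lam)) (hinv : MapsTo f Lam Lam)
    (hper : Lam ⊆ Function.periodicPts f) (hcrit : ∀ x ∈ closure Lam, ¬ IsCriticalPoint n f x)
    {c : ℝ} (hexp : ∀ x ∈ Lam, c ≤ limsup (birkhoffAverage ℝ f (logConorm n f) · x) atTop)
    (hV : V ∈ 𝓝ˢ (closure Lam)) {a₀ a₁ a₂ : ℝ} (ha₁ : 0 < a₁) (ha₀₁ : a₀ < a₁) (ha₁₂ : a₁ < a₂)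
    (ha₂ : a₂ < c) {x : M} (hx : x ∈ closure Lam)
    (hslow : ∀ k : ℕ, 1 ≤ k → birkhoffSum f (logConorm n f) k x ≤ k * a₀) (T : ℕ) :
    ∃ p ∈ Function.periodicPts f, T ≤ Function.minimalPeriod f p ∧
      (∀ i, f^[i] p ∈ V ∧ ¬ IsCriticalPoint n f (f^[i] p)) ∧
      birkhoffAverage ℝ f (logConorm n f) (Function.minimalPeriod f p) p < a₂ ∧
      ∀ k, 1 ≤ k → k ≤ Function.minimalPeriod f p →
        a₁ < birkhoffAverage ℝ f (logConorm n f) k (f^[Function.minimalPeriod f p - k] p) := by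
  have : LocallyCompactSpace M := ChartedSpace.locallyCompactSpace (EuclideanSpace ℝ (Fin n)) M
  obtain ⟨p, τ, hτ, hp, hpV, ⟨a, ha, hhyp⟩, hsum, j, hj⟩ :=
    exists_isPeriodicPt_of_slow_point hf.continuous hK hinv
      (fun x hx => continuousAt_logConorm hn hf (hcrit x hx))
      (inter_mem hV ((isOpen_setOf_not_isCriticalPoint hn hf).mem_nhdsSet.2 hcrit))
      (fun ε hε => exists_hasInverseBranches hn hf hK hcrit hε) ha₁ ha₀₁ ha₁₂ ha₂
      (fun x hx => by
        obtain ⟨m, hm, hxm⟩ := hper hx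
        exact ⟨m, hm, hxm, mul_le_birkhoffSum_of_le_limsup hm hxm (hexp x hx)⟩) hx hslow T
  have hmem : p ∈ Function.periodicPts f := ⟨τ, hτ, hp⟩
  have hdvd : Function.minimalPeriod f p ∣ τ := hp.minimalPeriod_dvd
  have hm := Function.minimalPeriod_pos_of_mem_periodicPts hmem
  have hpm := Function.isPeriodicPt_minimalPeriod f p
  replace hhyp := hhyp.of_dvd hpm hτ hdvd
  refine ⟨p, hmem, ?_, fun i => ?_, ?_, fun k hk1 hkm => ?_⟩
  · refine (lt_of_isPeriodicPt_of_birkhoffSum_lt hm hpm ?_ hj).le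
    exact le_trans (by gcongr) (hhyp.mul_le_birkhoffSum le_rfl |>.trans_eq (by simp))
  · rw [← hp.iterate_mod_apply]
    exact hpV _ (Nat.mod_lt _ hτ)
  · rw [birkhoffAverage, smul_eq_mul, inv_mul_lt_iff₀ (by exact_mod_cast hm)]
    exact birkhoffSum_lt_of_dvd hpm hdvd hsum
  · rw [birkhoffAverage, smul_eq_mul]
    refine ha.trans_le ((le_inv_mul_iff₀ (by exact_mod_cast hk1)).2 ?_)
    exact hhyp.mul_le_birkhoffSum hkm

end PeriodicOrbits

end C1Endo

theorem theorem4p1_general {n : ℕ} (hn : 1 ≤ n) {M : Type*} [TopologicalSpace M] [T2Space M]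
    [ChartedSpace (EuclideanSpace ℝ (Fin n)) M] [IsManifold (𝓡 n) ∞ M]
    [RiemannianBundle (fun x : M => TangentSpace (𝓡 n) x)]
    [IsContinuousRiemannianBundle (EuclideanSpace ℝ (Fin n)) (fun x : M => TangentSpace (𝓡 n) x)]
    (f : M → M) (hf : ContMDiff (𝓡 n) (𝓡 n) 1 f)
    (Lam : Set M) (hK : IsCompact (closure Lam)) (hinv : MapsTo f Lam Lam)
    (hper : Lam ⊆ Function.periodicPts f)
    (hcrit : ∀ x ∈ closure Lam, ¬ C1Endo.IsCriticalPoint n f x)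
    (c : ℝ)
    (hexp : ∀ x ∈ Lam, c ≤ limsup (fun k : ℕ =>
      (1 / (k : ℝ)) * ∑ i ∈ Finset.range k, C1Endo.logConorm n f (f^[i] x)) atTop) :
    C1Endo.UniformlyExpandingOn n f (closure Lam) ∨
    ∀ V ∈ 𝓝ˢ (closure Lam), ∀ γ' γ'' : ℝ, 0 < γ' → γ' < γ'' → γ'' < c → ∀ T : ℕ,
      ∃ p ∈ Function.periodicPts f, ∃ τ : ℕ, τ = Function.minimalPeriod f p ∧ T ≤ τ ∧
        (∀ i : ℕ, f^[i] p ∈ V ∧ ¬ C1Endo.IsCriticalPoint n f (f^[i] p)) ∧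
        (1 / (τ : ℝ)) * ∑ i ∈ Finset.range τ, C1Endo.logConorm n f (f^[i] p) < γ'' ∧
        ∀ k : ℕ, 1 ≤ k → k ≤ τ →
          γ' < (1 / (k : ℝ)) * ∑ i ∈ Finset.Icc 1 k, C1Endo.logConorm n f (f^[τ - i] p) := by
  refine or_iff_not_imp_left.2 fun hnot V hV γ' γ'' hγ' hγ hγ'' T => ?_
  obtain ⟨x, hx, hslow⟩ : ∃ x ∈ closure Lam, ∀ k : ℕ, 1 ≤ k →
      birkhoffSum f (C1Endo.logConorm n f) k x ≤ k * (γ' / 2) := by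
    contrapose! hnot
    exact C1Endo.uniformlyExpandingOn_of_lt_birkhoffSum hn hf hK (hinv.closure hf.continuous) hcrit
      (half_pos hγ') hnot
  have : LocallyCompactSpace M := ChartedSpace.locallyCompactSpace (EuclideanSpace ℝ (Fin n)) M
  have : IsManifold (𝓡 n) 1 M := IsManifold.of_le (n := ∞) (by simp)
  let : EMetricSpace M := EMetricSpace.ofRiemannianMetric (𝓡 n) M
  have : IsRiemannianManifold (𝓡 n) M := ⟨fun _ _ => rfl⟩
  simp only [one_div, ← smul_eq_mul] at hexp
  obtain ⟨p, hp, hT, hpV, hlt, hgt⟩ := C1Endo.exists_mem_periodicPts_of_slow_point hn hf hK hinv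
    hper hcrit hexp hV hγ' (half_lt_self hγ') hγ hγ'' hx hslow T
  refine ⟨p, hp, _, rfl, hT, hpV, ?_, fun k hk1 hk => ?_⟩
  · rw [one_div]
    exact hlt
  · rw [one_div, C1Endo.sum_Icc_iterate_sub hk]
    exact hgt k hk1 hk

theorem theorem4p1 {n : ℕ} (hn : 1 ≤ n) {M : Type*} [TopologicalSpace M] [T2Space M]
    [CompactSpace M] [ChartedSpace (EuclideanSpace ℝ (Fin n)) M] [IsManifold (𝓡 n) ∞ M]
    [RiemannianBundle (fun x : M => TangentSpace (𝓡 n) x)]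
    [IsContMDiffRiemannianBundle (𝓡 n) ∞ (EuclideanSpace ℝ (Fin n))
      (fun x : M => TangentSpace (𝓡 n) x)]
    (f : M → M) (hf : ContMDiff (𝓡 n) (𝓡 n) 1 f)
    (Lam : Set M) (hinv : MapsTo f Lam Lam) (hper : Lam ⊆ Function.periodicPts f)
    (hcrit : ∀ x ∈ closure Lam, ¬ C1Endo.IsCriticalPoint n f x)
    (c : ℝ) (hc : 0 < c)
    (hexp : ∀ x ∈ Lam, c ≤ limsup (fun k : ℕ =>
      (1 / (k : ℝ)) * ∑ i ∈ Finset.range k, C1Endo.logConorm n f (f^[i] x)) atTop) :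
    C1Endo.UniformlyExpandingOn n f (closure Lam) ∨
    ∀ V ∈ 𝓝ˢ (closure Lam), ∀ γ' γ'' : ℝ, 0 < γ' → γ' < γ'' → γ'' < c → ∀ T : ℕ,
      ∃ p ∈ Function.periodicPts f, ∃ τ : ℕ, τ = Function.minimalPeriod f p ∧ T ≤ τ ∧
        (∀ i : ℕ, f^[i] p ∈ V ∧ ¬ C1Endo.IsCriticalPoint n f (f^[i] p)) ∧
        (1 / (τ : ℝ)) * ∑ i ∈ Finset.range τ, C1Endo.logConorm n f (f^[i] p) < γ'' ∧
        ∀ k : ℕ, 1 ≤ k → k ≤ τ →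
          γ' < (1 / (k : ℝ)) * ∑ i ∈ Finset.Icc 1 k, C1Endo.logConorm n f (f^[τ - i] p) := by
  have := C1Endo.isContinuousRiemannianBundle_of_isContMDiffRiemannianBundle (𝓡 n) ∞
    (EuclideanSpace ℝ (Fin n)) (fun x : M => TangentSpace (𝓡 n) x)
  exact theorem4p1_general hn f hf Lam isClosed_closure.isCompact hinv hper hcrit c hexp
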